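/- Let $\Omega\subset\mathbb{R}^n$ be a bounded domain (open, connected, non-empty) with $C^\infty$ boundary $b\Omega$, and for $p\in b\Omega$ let $\nu_p$ be the outward unit normal to $b\Omega$ at $p$. A *majorant* is a continuous function $B:[0,\infty)\to[0,\infty)$ such that $B(0)=0$, $B$ is non-decreasing and $B(t)/t$ is non-increasing on $(0,\infty)$. It is *regular* if there is a constant $C>0$ such that for all sufficiently small $\delta>0$ $$\int_0^\delta \frac{B(t)}{t}\,dt+\delta\int_\delta^\infty\frac{B(t)}{t^2}\,dt\le C\,B(\delta),$$ both integrals being finite. A *family of curves transversal to $b\Omega$* is a $C^2$ map $\Gamma:b\Omega\times(-a,a)\to\mathbb{R}^n$, for some $a>0$, such that, with $\gamma_p(t):=\Gamma(p,t)$, one has $\gamma_p(0)=p$ for all $p\in b\Omega$, and there is $c>0$ with $\gamma_p'(t)\cdot\nu_p\le -c$ for all $p\in b\Omega$ and $t\in(-a,a)$. **Theorem.** Let $\Gamma$ be a family of curves transversal to $b\Omega$, let $B$ be a regular majorant and let $u:\Omega\to\mathbb{R}$ be harmonic. Suppose that $u$ is uniformly Lipschitz-$B$ along the curves of $\Gamma$,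 that is, there are constants $C>0$ and $0<\varepsilon\le a$ such that $$|u(\gamma_p(s))-u(\gamma_p(t))|\le C\,B(|s-t|)$$ for all $p\in b\Omega$ and all $s,t\in(0,\varepsilon)$ with $\gamma_p(s),\gamma_p(t)\in\Omega$. Then $u$ is Lipschitz-$B$ on $\Omega$, i.e. $u\in\Lambda_B(\Omega)$: there is a constant $C'>0$ such that $$|u(x)-u(y)|\le C'\,B(|x-y|)\qquad\text{for all }x,y\in\Omega.$$ -/

import Mathlib

open Set Filter Topology MeasureTheory
open scoped ContDiff

/-- A majorant: a continuous `B : [0, ∞) → [0, ∞)` with `B 0 = 0`, `B` non-decreasing and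
`B t / t` non-increasing on `(0, ∞)`. Only the values of `B` on `[0, ∞)` matter. -/
structure IsMajorant (B : ℝ → ℝ) : Prop where
  continuousOn : ContinuousOn B (Ici 0)
  nonneg : ∀ t, 0 ≤ t → 0 ≤ B t
  map_zero : B 0 = 0
  monotoneOn : MonotoneOn B (Ici 0)
  antitoneOn_div : AntitoneOn (fun t => B t / t) (Ioi 0)

/-- A regular majorant: for some `C > 0` and all sufficiently small `δ > 0`,
`∫₀^δ B t / t dt + δ ∫_δ^∞ B t / t² dt ≤ C * B δ`, both integrals being finite. -/
structure IsRegularMajorant (B : ℝ → ℝ) : Prop extends IsMajorant B where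
  regular : ∃ C > 0, ∃ δ₀ > 0, ∀ δ, 0 < δ → δ < δ₀ →
    IntegrableOn (fun t => B t / t) (Ioc 0 δ) ∧
    IntegrableOn (fun t => B t / t ^ 2) (Ioi δ) ∧
    (∫ t in Ioc 0 δ, B t / t) + δ * (∫ t in Ioi δ, B t / t ^ 2) ≤ C * B δ

/-- `ρ`, restricted to the open neighbourhood `V` of `p`, is a smooth local defining function of
`Ω`: it is `C^∞` with nowhere vanishing gradient on `V`, it is negative exactly at the points of
`Ω` in `V` and it vanishes exactly at the boundary points of `Ω` in `V`. -/
structure IsLocalDefiningFunction {n : ℕ} (Ω : Set (EuclideanSpace ℝ (Fin n)))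
    (p : EuclideanSpace ℝ (Fin n)) (V : Set (EuclideanSpace ℝ (Fin n)))
    (ρ : EuclideanSpace ℝ (Fin n) → ℝ) : Prop where
  isOpen : IsOpen V
  mem : p ∈ V
  contDiffOn : ContDiffOn ℝ ∞ ρ V
  gradient_ne_zero : ∀ x ∈ V, gradient ρ x ≠ 0
  mem_iff : ∀ x ∈ V, (x ∈ Ω ↔ ρ x < 0)
  mem_frontier_iff : ∀ x ∈ V, (x ∈ frontier Ω ↔ ρ x = 0)

/-- `Ω` has `C^∞` boundary. -/
def HasSmoothBoundary {n : ℕ} (Ω : Set (EuclideanSpace ℝ (Fin n))) : Prop :=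
  ∀ p ∈ frontier Ω, ∃ V ρ, IsLocalDefiningFunction Ω p V ρ

/-- `ν` is the outward unit normal to `frontier Ω` at `p`: the normalized gradient of a local
defining function (which does not depend on the choice of the latter). -/
def IsOutwardUnitNormal {n : ℕ} (Ω : Set (EuclideanSpace ℝ (Fin n)))
    (p ν : EuclideanSpace ℝ (Fin n)) : Prop :=
  ∃ V ρ, IsLocalDefiningFunction Ω p V ρ ∧ ν = ‖gradient ρ p‖⁻¹ • gradient ρ p

/-- `Γ : frontier Ω × (-a, a) → ℝⁿ`, `Γ p t = γ_p(t)`, is a family of curves transversal to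
`frontier Ω`. For a smooth hypersurface `frontier Ω`, `ContDiffOn` on the set
`frontier Ω ×ˢ Ioo (-a) a` is the usual notion of a `C²` map on that submanifold (a map that extends
locally to a `C²` map of the ambient space is `C²` in this sense, and conversely such a map becomes
`C²` when composed with a smooth parametrization of the submanifold). -/
structure IsTransversalFamily {n : ℕ} (Ω : Set (EuclideanSpace ℝ (Fin n))) (a : ℝ)
    (Γ : EuclideanSpace ℝ (Fin n) → ℝ → EuclideanSpace ℝ (Fin n)) : Prop where
  pos : 0 < a
  contDiffOn : ContDiffOn ℝ 2 (fun q : EuclideanSpace ℝ (Fin n) × ℝ => Γ q.1 q.2)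
    (frontier Ω ×ˢ Ioo (-a) a)
  start : ∀ p ∈ frontier Ω, Γ p 0 = p
  transversal : ∃ c > 0, ∀ p ∈ frontier Ω, ∀ ν, IsOutwardUnitNormal Ω p ν →
    ∀ t ∈ Ioo (-a) a, inner ℝ (deriv (Γ p) t) ν ≤ -c

/-- `f` is (uniformly) Lipschitz-`B` along the part in `Ω` of the curves `Γ p`, `0 < t < a`, near
the boundary: neither the constant `C` nor the bound `ε` on the parameters depends on `p`. -/
def TransversallyLipschitz {n : ℕ} (B : ℝ → ℝ) (Ω : Set (EuclideanSpace ℝ (Fin n))) (a : ℝ)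
    (Γ : EuclideanSpace ℝ (Fin n) → ℝ → EuclideanSpace ℝ (Fin n))
    (f : EuclideanSpace ℝ (Fin n) → ℝ) : Prop :=
  ∃ C > 0, ∃ ε > 0, ε ≤ a ∧ ∀ p ∈ frontier Ω, ∀ s ∈ Ioo 0 ε, ∀ t ∈ Ioo 0 ε,
    Γ p s ∈ Ω → Γ p t ∈ Ω → |f (Γ p s) - f (Γ p t)| ≤ C * B |s - t|

/-- `f ∈ Λ_B(Ω)`: `f` is Lipschitz-`B` on `Ω`. -/
def LipschitzMajorant {n : ℕ} (B : ℝ → ℝ) (Ω : Set (EuclideanSpace ℝ (Fin n)))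
    (f : EuclideanSpace ℝ (Fin n) → ℝ) : Prop :=
  ∃ C > 0, ∀ x ∈ Ω, ∀ y ∈ Ω, |f x - f y| ≤ C * B ‖x - y‖

/-!
The proof rests on the gradient estimate `‖∇u‖ ≤ N * B d / d`, where `d` is the distance to the
complement of `Ω` (`exists_gradientBound`).

Near a boundary point `p`, put `X = γ_p'(0)`. The curves of the family cover the part of `Ω` near
`p`, and the shift by a time `h` along them is the translation by `h • X` up to an error `κ * h`,
with `κ` as small as desired (`IsTransversalFamily.exists_curve_through`). This is seen in the chart
`w ↦ Γ (k w) (τ w)` of `exists_transversal_chart`, which is tangent to the identity. Moreover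
translations by `s • X` increase `d` at a linear rate (`IsTransversalFamily.exists_infDist_add_le`).

Suppose that `‖∇u‖ ≤ N * B d / d` is known with some `N`. For `y` with `d y` at least `e`, the
function `z ↦ u (z + e • X) - u z` is harmonic on the ball of radius `e / 4` about `y`. By the
Lipschitz condition along the curves and the gradient bound, it is at most `(C + 2 * κ * N) * B e`
there, so the interior gradient estimate for harmonic functions bounds `∇u (y + e • X) - ∇u y` by a
constant multiple of `(C + 2 * κ * N) * B e / e` (`exists_norm_fderiv_sub_le`). Adding this up along
a geometric progression `e, λ e, λ² e, …` costs only a constant factor, because `B` is regular, and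
for small `κ` one obtains the same gradient bound with `A + N / 2` instead of `N`
(`exists_norm_fderiv_le_near_boundary`). Hence `N` may be replaced by `2 * A`. For this argument
some finite `N` must be available at the start; this is achieved by replacing `d` with `d - τ`, with
`A` independent of `τ > 0`.

The Lipschitz condition follows by the argument of Hardy and Littlewood: two points at distance `δ`
near the boundary are both moved by a multiple of `δ` in the direction `X`. The first half of the
regularity condition controls the change of `u`
(`GradientBound.exists_abs_sub_le_near_boundary`).

The absorption of constants needs `B > 0`. A majorant that vanishes at one positive number vanishes
identically; then `u` is constant along the curves, hence Hölder continuous with exponent `1 / 2`,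
and constant by the strong maximum principle (`eq_of_transversallyConstant`).

The facts on harmonic functions are derived from a smooth mean value property, proved by integrating
by parts against a radial bump function (`integral_mul_radialKernel_eq`).
-/

/-! ### The mean value property of harmonic functions -/

section HarmonicFunctions

open Laplacian InnerProductSpace

variable {E : Type*} [NormedAddCommGroup E]

/-- The smooth function `x ↦ exp (-1 / x) / x ^ 2` for `0 < x`, extended by zero. -/
noncomputable def expNegInvGlueDeriv (s : ℝ) : ℝ := deriv expNegInvGlue s

lemma expNegInvGlueDeriv_of_nonpos {s : ℝ} (hs : s ≤ 0) : expNegInvGlueDeriv s = 0 := by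
  have hcont : Continuous expNegInvGlueDeriv :=
    (expNegInvGlue.contDiff (n := 1)).continuous_deriv le_rfl
  have hlt : ∀ t < 0, expNegInvGlueDeriv t = 0 := by
    intro t ht
    have : expNegInvGlue =ᶠ[𝓝 t] fun _ => 0 := by
      filter_upwards [Iio_mem_nhds ht] with y hy
      exact expNegInvGlue.zero_of_nonpos (le_of_lt hy)
    simp [expNegInvGlueDeriv, this.deriv_eq]
  have hcl : IsClosed {t | expNegInvGlueDeriv t = 0} := isClosed_eq hcont continuous_const
  have : Iic (0 : ℝ) ⊆ {t | expNegInvGlueDeriv t = 0} := by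
    rw [← closure_Iio]
    exact closure_minimal hlt hcl
  exact this hs

lemma expNegInvGlueDeriv_pos {s : ℝ} (hs : 0 < s) : 0 < expNegInvGlueDeriv s := by
  have h1 : expNegInvGlue =ᶠ[𝓝 s] fun y => Real.exp (-y⁻¹) := by
    filter_upwards [Ioi_mem_nhds hs] with y hy
    simp [expNegInvGlue, not_le.2 (mem_Ioi.1 hy)]
  have h2 : HasDerivAt (fun y : ℝ => Real.exp (-y⁻¹)) (Real.exp (-s⁻¹) * (- (-(s ^ 2)⁻¹))) s :=
    ((hasDerivAt_inv hs.ne').neg).exp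
  rw [expNegInvGlueDeriv, h1.deriv_eq, h2.deriv]
  have : 0 < (s ^ 2)⁻¹ := by positivity
  rw [neg_neg]
  positivity

lemma expNegInvGlueDeriv_nonneg (s : ℝ) : 0 ≤ expNegInvGlueDeriv s := by
  rcases le_or_gt s 0 with h | h
  · rw [expNegInvGlueDeriv_of_nonpos h]
  · exact (expNegInvGlueDeriv_pos h).le

lemma expNegInvGlueDeriv_contDiff : ContDiff ℝ 1 expNegInvGlueDeriv := by
  have := (expNegInvGlue.contDiff (n := 2))
  exact (contDiff_succ_iff_deriv (n := 1).1 (by simpa [one_add_one_eq_two] using this)).2.2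

/-- A radial bump function, supported in the closed unit ball. -/
noncomputable def radialPotential (z : E) : ℝ := expNegInvGlue (1 - ‖z‖ ^ 2)

/-- A radial averaging kernel, positive exactly on the open unit ball. The identity
`2 * radialKernel z • z = -∇ (radialPotential z)` makes it suitable for integrating by parts. -/
noncomputable def radialKernel (z : E) : ℝ := expNegInvGlueDeriv (1 - ‖z‖ ^ 2)

lemma radialKernel_nonneg (z : E) : 0 ≤ radialKernel z := expNegInvGlueDeriv_nonneg _

lemma radialKernel_pos {z : E} (hz : ‖z‖ < 1) : 0 < radialKernel z :=
  expNegInvGlueDeriv_pos (by nlinarith [norm_nonneg z])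

lemma radialKernel_eq_zero {z : E} (hz : 1 ≤ ‖z‖) : radialKernel z = 0 :=
  expNegInvGlueDeriv_of_nonpos (by nlinarith [norm_nonneg z])

lemma radialPotential_eq_zero {z : E} (hz : 1 ≤ ‖z‖) : radialPotential z = 0 :=
  expNegInvGlue.zero_of_nonpos (by nlinarith [norm_nonneg z])

variable [InnerProductSpace ℝ E]

lemma radialPotential_contDiff : ContDiff ℝ 1 (radialPotential : E → ℝ) :=
  (expNegInvGlue.contDiff (n := 1)).comp (contDiff_const.sub (contDiff_norm_sq ℝ))

lemma radialKernel_contDiff : ContDiff ℝ 1 (radialKernel : E → ℝ) :=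
  expNegInvGlueDeriv_contDiff.comp (contDiff_const.sub (contDiff_norm_sq ℝ))

lemma fderiv_radialPotential (z v : E) :
    fderiv ℝ radialPotential z v = -2 * radialKernel z * inner ℝ z v := by
  have h1 : HasDerivAt expNegInvGlue (expNegInvGlueDeriv (1 - ‖z‖ ^ 2)) (1 - ‖z‖ ^ 2) :=
    ((expNegInvGlue.contDiff (n := 1)).differentiable one_ne_zero _).hasDerivAt
  have h2 : HasFDerivAt (fun z : E => 1 - ‖z‖ ^ 2) (-(2 • innerSL ℝ z)) z :=
    (hasStrictFDerivAt_norm_sq z).hasFDerivAt.const_sub 1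
  have h3 := h1.comp_hasFDerivAt z h2
  have h4 : fderiv ℝ radialPotential z = _ := h3.fderiv
  rw [h4]
  simp [radialKernel]
  ring

variable [FiniteDimensional ℝ E]

lemma radialKernel_hasCompactSupport : HasCompactSupport (radialKernel : E → ℝ) :=
  HasCompactSupport.intro (isCompact_closedBall (0 : E) 1) fun z hz =>
    radialKernel_eq_zero (by simpa using (not_le.1 (by simpa using hz) : 1 < ‖z‖).le)

lemma radialPotential_hasCompactSupport : HasCompactSupport (radialPotential : E → ℝ) :=
  HasCompactSupport.intro (isCompact_closedBall (0 : E) 1) fun z hz =>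
    radialPotential_eq_zero (by simpa using (not_le.1 (by simpa using hz) : 1 < ‖z‖).le)

/-- A harmonic function on an open ball agrees, near a smaller closed ball, with a compactly
supported `C^2` function that is not larger in absolute value. -/
lemma exists_contDiff_extension {u : E → ℝ} {x : E} {r R : ℝ} (hr : 0 < r) (hrR : r < R)
    (hu : HarmonicOnNhd u (Metric.ball x R)) :
    ∃ w : E → ℝ, ContDiff ℝ 2 w ∧ HasCompactSupport w ∧ (∀ y ∈ Metric.ball x r, w y = u y) ∧
      (∀ y ∈ Metric.ball x r, (Δ w) y = 0) ∧
      (∀ y, y ∉ Metric.ball x R → w y = 0) ∧ ∀ y, |w y| ≤ |u y| := by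
  have hc : r < (r + R) / 2 := by linarith
  let χ : ContDiffBump x := ⟨r, (r + R) / 2, hr, hc⟩
  have hsupp : tsupport χ ⊆ Metric.ball x R := by
    rw [χ.tsupport_eq]
    exact Metric.closedBall_subset_ball (by change (r + R) / 2 < R; linarith)
  have heq : ∀ y ∈ Metric.ball x r, (fun y => χ y * u y) =ᶠ[𝓝 y] u := by
    intro y hy
    filter_upwards [Metric.isOpen_ball.mem_nhds hy] with z hz
    rw [χ.one_of_mem_closedBall (Metric.ball_subset_closedBall hz), one_mul]
  refine ⟨fun y => χ y * u y, ?_, χ.hasCompactSupport.mul_right,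
    fun y hy => (heq y hy).self_of_nhds,
    ?_, ?_, ?_⟩
  · rw [contDiff_iff_contDiffAt]
    intro y
    by_cases hy : y ∈ tsupport χ
    · exact (χ.contDiff.contDiffAt).mul (hu y (hsupp hy)).1
    · have : (fun y => χ y * u y) =ᶠ[𝓝 y] fun _ => 0 := by
        filter_upwards [(isClosed_tsupport χ).isOpen_compl.mem_nhds hy] with z hz
        rw [image_eq_zero_of_notMem_tsupport hz, zero_mul]
      exact contDiffAt_const.congr_of_eventuallyEq this
  · intro y hy
    rw [(laplacian_congr_nhds (heq y hy)).self_of_nhds]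
    exact (hu y (Metric.ball_subset_ball hrR.le hy)).2.self_of_nhds
  · intro y hy
    simp only
    rw [image_eq_zero_of_notMem_tsupport fun h => hy (hsupp h), zero_mul]
  · intro y
    rw [abs_mul, abs_of_nonneg χ.nonneg]
    exact mul_le_of_le_one_left (abs_nonneg _) χ.le_one

variable [MeasurableSpace E] [BorelSpace E]

lemma integral_radialKernel_pos : 0 < ∫ z : E, radialKernel z := by
  refine (integral_pos_iff_support_of_nonneg radialKernel_nonneg
    (radialKernel_contDiff.continuous.integrable_of_hasCompactSupport
      radialKernel_hasCompactSupport)).2 ?_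
  refine IsOpen.measure_pos _ (radialKernel_contDiff.continuous.isOpen_support) ⟨0, ?_⟩
  exact (radialKernel_pos (by simp)).ne'

/-- The radial derivative of a harmonic function has mean zero: integrating by parts against
`radialPotential` turns the integral into one of the Laplacian. -/
lemma integral_fderiv_mul_radialKernel_eq_zero {w : E → ℝ} (hw : ContDiff ℝ 2 w) {x : E} {δ R : ℝ}
    (hδ : 0 ≤ δ) (hδR : δ ≤ R) (hΔ : ∀ y ∈ Metric.closedBall x R, (Δ w) y = 0) :
    ∫ z, fderiv ℝ w (x + δ • z) z * radialKernel z = 0 := by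
  set b := stdOrthonormalBasis ℝ E
  have hdw : ContDiff ℝ 1 (fderiv ℝ w) := hw.fderiv_right (by norm_num)
  set D : ∀ _ : Fin (Module.finrank ℝ E), E → ℝ := fun i z => fderiv ℝ w (x + δ • z) (b i) with hD
  have hDc : ∀ i, ContDiff ℝ 1 (D i) := fun i =>
    (hdw.comp (contDiff_const.add (contDiff_const.smul contDiff_id))).clm_apply contDiff_const
  have hDd : ∀ i z, fderiv ℝ (D i) z (b i)
      = δ * iteratedFDeriv ℝ 2 w (x + δ • z) ![b i, b i] := by
    intro i z
    have h1 : HasFDerivAt (fun z : E => x + δ • z) (δ • ContinuousLinearMap.id ℝ E) z :=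
      ((hasFDerivAt_id z).const_smul δ).const_add x
    have h2 : HasFDerivAt (fderiv ℝ w) (fderiv ℝ (fderiv ℝ w) (x + δ • z)) (x + δ • z) :=
      (hdw.differentiable one_ne_zero _).hasFDerivAt
    have h3 := (h2.comp z h1).clm_apply (hasFDerivAt_const (b i) z)
    have h4 : fderiv ℝ (D i) z = _ := h3.fderiv
    rw [h4, iteratedFDeriv_two_apply]
    simp
  have hint : ∀ {f g : E → ℝ}, Continuous f → Continuous g → HasCompactSupport g →
      Integrable (fun z => f z * g z) := fun hf hg hs =>
    (hf.mul hg).integrable_of_hasCompactSupport hs.mul_left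
  have hψ := radialPotential_contDiff (E := E)
  have hψ' : ∀ i, Continuous fun z => fderiv ℝ (radialPotential : E → ℝ) z (b i) := fun i =>
    (hψ.continuous_fderiv one_ne_zero).clm_apply continuous_const
  have hD' : ∀ i, Continuous fun z => fderiv ℝ (D i) z (b i) := fun i =>
    ((hDc i).continuous_fderiv one_ne_zero).clm_apply continuous_const
  have hψs : ∀ i, HasCompactSupport fun z => fderiv ℝ (radialPotential : E → ℝ) z (b i) := fun i =>
    radialPotential_hasCompactSupport.fderiv_apply ℝ (b i)
  have key : ∀ z, fderiv ℝ w (x + δ • z) z * radialKernel z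
      = ∑ i, (-1 / 2) * (D i z * fderiv ℝ (radialPotential : E → ℝ) z (b i)) := by
    intro z
    have h1 : ∀ T : E →L[ℝ] ℝ, T z = ∑ i, inner ℝ (b i) z * T (b i) := by
      intro T
      conv_lhs => rw [← b.sum_repr' z]
      simp
    rw [h1, Finset.sum_mul]
    refine Finset.sum_congr rfl fun i _ => ?_
    rw [fderiv_radialPotential, real_inner_comm]
    ring
  simp_rw [key]
  rw [integral_finsetSum _ fun i _ =>
    (hint (hDc i).continuous (hψ' i) (hψs i)).const_mul _]
  have parts : ∀ i, ∫ z, (-1 / 2) * (D i z * fderiv ℝ (radialPotential : E → ℝ) z (b i))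
      = ∫ z, (δ / 2) * (iteratedFDeriv ℝ 2 w (x + δ • z) ![b i, b i] * radialPotential z) := by
    intro i
    rw [integral_const_mul, integral_mul_fderiv_eq_neg_fderiv_mul_of_integrable
      (hint (hD' i) hψ.continuous radialPotential_hasCompactSupport)
      (hint (hDc i).continuous (hψ' i) (hψs i))
      (hint (hDc i).continuous hψ.continuous radialPotential_hasCompactSupport)
      (fun z _ => (hDc i).differentiable one_ne_zero z)
      (fun z _ => hψ.differentiable one_ne_zero z)]
    simp_rw [hDd, mul_assoc]
    rw [integral_const_mul, integral_const_mul]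
    ring
  simp_rw [parts]
  rw [← integral_finsetSum]
  · refine integral_eq_zero_of_ae (Eventually.of_forall fun z => ?_)
    have hlap : (Δ w) (x + δ • z) = ∑ i, iteratedFDeriv ℝ 2 w (x + δ • z) ![b i, b i] := by
      rw [laplacian_eq_iteratedFDeriv_stdOrthonormalBasis]
    simp only [Pi.zero_apply]
    rw [← Finset.mul_sum, ← Finset.sum_mul, ← hlap]
    rcases le_or_gt 1 ‖z‖ with h | h
    · rw [radialPotential_eq_zero h]; ring
    · rw [hΔ]
      · ring
      · rw [mem_closedBall_iff_norm, add_sub_cancel_left, norm_smul, Real.norm_of_nonneg hδ]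
        nlinarith [norm_nonneg z]
  · intro i _
    have : Continuous fun z => iteratedFDeriv ℝ 2 w (x + δ • z) ![b i, b i] := by
      simp_rw [iteratedFDeriv_two_apply]
      have := hdw.continuous_fderiv one_ne_zero
      simp only [Matrix.cons_val_zero, Matrix.cons_val_one]
      fun_prop
    exact (hint this hψ.continuous radialPotential_hasCompactSupport).const_mul _

/-- **Mean value property**, smooth version: averages of a function against dilates of a radial
kernel are constant as long as the function is harmonic on the ball over which they are taken. -/
theorem integral_mul_radialKernel_eq {w : E → ℝ} (hw : ContDiff ℝ 2 w)
    (hws : HasCompactSupport w) {x : E} {R : ℝ} (hR : 0 ≤ R)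
    (hΔ : ∀ y ∈ Metric.closedBall x R, (Δ w) y = 0) :
    ∫ z, w (x + R • z) * radialKernel z = w x * ∫ z : E, radialKernel z := by
  have hw1 : ContDiff ℝ 1 w := hw.of_le (by norm_num)
  obtain ⟨M, hM⟩ := (hws.fderiv ℝ).exists_bound_of_continuous (hw1.continuous_fderiv one_ne_zero)
  have hφ : Continuous (radialKernel : E → ℝ) := radialKernel_contDiff.continuous
  have hint : ∀ {f : E → ℝ}, Continuous f → Integrable (fun z => f z * radialKernel z) := fun hf =>
    (hf.mul hφ).integrable_of_hasCompactSupport radialKernel_hasCompactSupport.mul_left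
  have hderiv : ∀ δ : ℝ, HasDerivAt (fun δ : ℝ => ∫ z, w (x + δ • z) * radialKernel z)
      (∫ z, fderiv ℝ w (x + δ • z) z * radialKernel z) δ := by
    intro δ
    refine (hasDerivAt_integral_of_dominated_loc_of_deriv_le (𝕜 := ℝ) (μ := volume) (s := univ)
      (F := fun (δ : ℝ) (z : E) => w (x + δ • z) * radialKernel z)
      (F' := fun (δ : ℝ) (z : E) => fderiv ℝ w (x + δ • z) z * radialKernel z)
      (bound := fun z : E => (M * ‖z‖) * radialKernel z) univ_mem ?_ ?_ ?_ ?_ ?_ ?_).2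
    · refine Eventually.of_forall fun t => (Continuous.aestronglyMeasurable ?_)
      have := hw.continuous
      fun_prop
    · have := hw.continuous
      exact hint (by fun_prop)
    · have := hw1.continuous_fderiv one_ne_zero
      exact Continuous.aestronglyMeasurable (by fun_prop)
    · refine Eventually.of_forall fun z t _ => ?_
      rw [norm_mul, Real.norm_of_nonneg (radialKernel_nonneg z)]
      exact mul_le_mul_of_nonneg_right
        (((fderiv ℝ w _).le_opNorm z).trans (mul_le_mul_of_nonneg_right (hM _) (norm_nonneg z)))
        (radialKernel_nonneg z)
    · exact hint (f := fun z : E => M * ‖z‖) (by fun_prop)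
    · refine Eventually.of_forall fun z t _ => ?_
      have h1 : HasDerivAt (fun t : ℝ => x + t • z) z t := by
        simpa using ((hasDerivAt_id t).smul_const z).const_add x
      exact (((hw1.differentiable one_ne_zero _).hasFDerivAt).comp_hasDerivAt t h1).mul_const _
  have hconst := constant_of_has_deriv_right_zero (a := 0) (b := R)
    (f := fun δ : ℝ => ∫ z, w (x + δ • z) * radialKernel z)
    (fun δ _ => (hderiv δ).continuousAt.continuousWithinAt) (fun δ hδ => by
      have := (hderiv δ).hasDerivWithinAt (s := Ici δ)
      rwa [integral_fderiv_mul_radialKernel_eq_zero hw hδ.1 hδ.2.le hΔ] at this)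
    R ⟨hR, le_rfl⟩
  simp only [zero_smul, add_zero] at hconst
  rw [hconst, integral_const_mul]

/-- **Interior gradient estimate** for harmonic functions. -/
theorem exists_norm_fderiv_le_of_harmonic : ∃ C > 0, ∀ (u : E → ℝ) (x : E) (R M : ℝ), 0 < R →
    HarmonicOnNhd u (Metric.ball x R) → (∀ y ∈ Metric.ball x R, |u y| ≤ M) →
    ‖fderiv ℝ u x‖ ≤ C * (M / R) := by
  obtain ⟨L, hL⟩ := radialKernel_contDiff.lipschitzWith_of_hasCompactSupport
    (radialKernel_hasCompactSupport (E := E)) one_ne_zero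
  set I := ∫ z : E, radialKernel z with hI
  have hIpos : 0 < I := integral_radialKernel_pos
  set V := (volume (Metric.closedBall (0 : E) 2)).toReal with hV
  have hV0 : 0 ≤ V := ENNReal.toReal_nonneg
  refine ⟨4 * L * V / I + 1, by positivity, fun u x R M hR hu hM => ?_⟩
  have hM0 : 0 ≤ M := (abs_nonneg _).trans (hM x (Metric.mem_ball_self hR))
  obtain ⟨w, hw, hws, hwu, hΔ, hw0, hwle⟩ :=
    exists_contDiff_extension (r := R / 2) (by linarith) (by linarith) hu
  have hwM : ∀ y, |w y| ≤ M := by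
    intro y
    by_cases hy : y ∈ Metric.ball x R
    · exact (hwle y).trans (hM y hy)
    · rw [hw0 y hy, abs_zero]; exact hM0
  set δ := R / 4 with hδ
  have hδ0 : 0 < δ := by positivity
  have hmv : ∀ y ∈ Metric.ball x δ, ∫ z, w (y + δ • z) * radialKernel z = w y * I := by
    intro y hy
    refine integral_mul_radialKernel_eq hw hws hδ0.le fun z hz => hΔ z ?_
    rw [Metric.mem_ball] at hy ⊢
    rw [Metric.mem_closedBall] at hz
    linarith [dist_triangle z y x]
  have hφc : Continuous (radialKernel : E → ℝ) := radialKernel_contDiff.continuous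
  have hlip : ∀ y ∈ Metric.ball x δ, ‖w y - w x‖ ≤ (L * V / I) * (M / δ) * ‖y - x‖ := by
    intro y hy
    set h := δ⁻¹ • (y - x) with hh
    have hδh : δ • h = y - x := by rw [hh, smul_smul, mul_inv_cancel₀ hδ0.ne', one_smul]
    have hnh : ‖h‖ = ‖y - x‖ / δ := by
      rw [hh, norm_smul, norm_inv, Real.norm_of_nonneg hδ0.le]; ring
    have hh1 : ‖h‖ ≤ 1 := by
      rw [hnh, div_le_one hδ0]
      exact (mem_ball_iff_norm.1 hy).le
    have hshift : ∫ z, w (y + δ • z) * radialKernel z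
        = ∫ z, w (x + δ • z) * radialKernel (z - h) := by
      rw [← integral_sub_right_eq_self (fun z => w (y + δ • z) * radialKernel z) h]
      refine integral_congr_ae (Eventually.of_forall fun z => ?_)
      simp only [smul_sub, hδh]
      congr 2
      abel
    have hwc := hw.continuous
    have hsc : HasCompactSupport fun z : E => radialKernel (z - h) :=
      radialKernel_hasCompactSupport.comp_homeomorph (Homeomorph.subRight h)
    have hi1 : Integrable fun z : E => w (x + δ • z) * radialKernel (z - h) :=
      Continuous.integrable_of_hasCompactSupport (by fun_prop) hsc.mul_left
    have hi2 : Integrable fun z : E => w (x + δ • z) * radialKernel z :=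
      Continuous.integrable_of_hasCompactSupport (by fun_prop)
        radialKernel_hasCompactSupport.mul_left
    have hdiff : (w y - w x) * I
        = ∫ z, w (x + δ • z) * (radialKernel (z - h) - radialKernel z) := by
      rw [sub_mul, ← hmv y hy, ← hmv x (Metric.mem_ball_self hδ0), hshift, ← integral_sub hi1 hi2]
      simp_rw [mul_sub]
    have hzero : ∀ z, z ∉ Metric.closedBall (0 : E) 2 →
        w (x + δ • z) * (radialKernel (z - h) - radialKernel z) = 0 := by
      intro z hz
      have hz' : 2 < ‖z‖ := by simpa using hz
      have hzh : 1 ≤ ‖z - h‖ := by linarith [norm_sub_norm_le z h]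
      rw [radialKernel_eq_zero hzh, radialKernel_eq_zero (by linarith), sub_zero, mul_zero]
    have hbd : ‖(w y - w x) * I‖ ≤ (M * (L * ‖h‖)) * V := by
      rw [hdiff, ← setIntegral_eq_integral_of_forall_compl_eq_zero hzero]
      refine norm_setIntegral_le_of_norm_le_const measure_closedBall_lt_top fun z _ => ?_
      rw [norm_mul]
      refine mul_le_mul (hwM _) ?_ (norm_nonneg _) hM0
      have := hL.norm_sub_le (z - h) z
      rwa [sub_sub_cancel_left, norm_neg] at this
    rw [norm_mul, Real.norm_of_nonneg hIpos.le, ← le_div_iff₀ hIpos] at hbd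
    refine hbd.trans (le_of_eq ?_)
    rw [hnh]
    ring
  have hfd : fderiv ℝ u x = fderiv ℝ w x := by
    refine Filter.EventuallyEq.fderiv_eq ?_
    filter_upwards [Metric.ball_mem_nhds x (half_pos hR)] with y hy
    exact (hwu y hy).symm
  rw [hfd]
  have h1 : ‖fderiv ℝ w x‖ ≤ (L * V / I) * (M / δ) := by
    refine norm_fderiv_le_of_lip' ℝ (by positivity) ?_
    filter_upwards [Metric.ball_mem_nhds x hδ0] with y hy using hlip y hy
  refine h1.trans ?_
  have h2 : (L * V / I) * (M / δ) = (4 * L * V / I) * (M / R) := by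
    rw [hδ]; field_simp
  rw [h2]
  have : 0 ≤ M / R := by positivity
  nlinarith

/-- **Strong maximum principle** on connected open sets. -/
theorem eq_of_harmonic_of_isMaxOn {u : E → ℝ} {Ω : Set E} (hΩ : IsOpen Ω)
    (hconn : IsPreconnected Ω) (hu : HarmonicOnNhd u Ω) {x₀ : E} (hx₀ : x₀ ∈ Ω)
    (hmax : IsMaxOn u Ω x₀) : ∀ y ∈ Ω, u y = u x₀ := by
  have hφc : Continuous (radialKernel : E → ℝ) := radialKernel_contDiff.continuous
  have hcont : ContinuousOn u Ω := fun y hy => (hu y hy).1.continuousAt.continuousWithinAt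
  have hopen : IsOpen {y ∈ Ω | u y = u x₀} := by
    rw [Metric.isOpen_iff]
    rintro x ⟨hx, hux⟩
    obtain ⟨R, hR, hRΩ⟩ := Metric.isOpen_iff.1 hΩ x hx
    refine ⟨R / 4, by positivity, fun y hy => ⟨hRΩ (Metric.ball_subset_ball (by linarith) hy), ?_⟩⟩
    obtain ⟨w, hw, hws, hwu, hΔ, -, -⟩ := exists_contDiff_extension (r := R / 2) (by linarith)
      (by linarith) (hu.mono hRΩ)
    have hwc := hw.continuous
    set δ := R / 4 with hδ
    have hδ0 : 0 < δ := by positivity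
    have hwx : w x = u x₀ := by rw [hwu x (Metric.mem_ball_self (by linarith)), hux]
    have hmv := integral_mul_radialKernel_eq hw hws hδ0.le fun z hz => hΔ z
      (Metric.closedBall_subset_ball (by linarith) hz)
    have hle : ∀ z ∈ Metric.ball x (R / 2), w z ≤ w x := fun z hz => by
      rw [hwu z hz, hwx]
      exact hmax (hRΩ (Metric.ball_subset_ball (by linarith) hz))
    set f : E → ℝ := fun z => (w x - w (x + δ • z)) * radialKernel z with hf
    have hfc : Continuous f := by fun_prop
    have hfi : Integrable f :=
      hfc.integrable_of_hasCompactSupport radialKernel_hasCompactSupport.mul_left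
    have hf0 : ∫ z, f z = 0 := by
      have hi : Integrable fun z : E => w (x + δ • z) * radialKernel z :=
        Continuous.integrable_of_hasCompactSupport (by fun_prop)
          radialKernel_hasCompactSupport.mul_left
      have hi' : Integrable fun z : E => w x * radialKernel z :=
        Continuous.integrable_of_hasCompactSupport (by fun_prop)
          radialKernel_hasCompactSupport.mul_left
      simp_rw [hf, sub_mul]
      rw [integral_sub hi' hi, hmv, integral_const_mul, sub_self]
    have hfn : 0 ≤ f := by
      intro z
      rcases le_or_gt 1 ‖z‖ with h | h
      · simp [hf, radialKernel_eq_zero h]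
      · refine mul_nonneg (sub_nonneg.2 (hle _ ?_)) (radialKernel_nonneg z)
        rw [mem_ball_iff_norm, add_sub_cancel_left, norm_smul, Real.norm_of_nonneg hδ0.le]
        nlinarith
    have hfz : f = 0 := by
      have h1 := (integral_eq_zero_iff_of_nonneg hfn hfi).1 hf0
      exact hfc.ae_eq_iff_eq volume continuous_const |>.1 h1
    have hz : ‖δ⁻¹ • (y - x)‖ < 1 := by
      rw [norm_smul, norm_inv, Real.norm_of_nonneg hδ0.le, inv_mul_lt_iff₀ hδ0, mul_one]
      exact mem_ball_iff_norm.1 hy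
    have h2 := congrFun hfz (δ⁻¹ • (y - x))
    simp only [hf, Pi.zero_apply, mul_eq_zero, (radialKernel_pos hz).ne', or_false, smul_smul,
      mul_inv_cancel₀ hδ0.ne', one_smul, add_sub_cancel] at h2
    rw [← hwu y (Metric.ball_subset_ball (by linarith) hy), ← hwx]
    linarith
  have hopen' : IsOpen {y ∈ Ω | u y ≠ u x₀} :=
    hcont.isOpen_inter_preimage hΩ isOpen_compl_singleton
  intro y hy
  by_contra hne
  obtain ⟨z, -, hz1, hz2⟩ := hconn _ _ hopen hopen'
    (fun z hz => by by_cases h : u z = u x₀ <;> simp [hz, h]) ⟨x₀, hx₀, hx₀, rfl⟩ ⟨y, hy, hy, hne⟩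
  exact hz2.2 hz1.2

end HarmonicFunctions

/-! ### Domains with smooth boundary and transversal curves -/

section Geometry

section StrictDerivative

variable {E : Type*} [NormedAddCommGroup E] [NormedSpace ℝ E]

/-- If `ρ` has negative derivative at `p` in the direction `X`, then near `p` it strictly decreases
along all directions close to `X`. -/
lemma HasStrictFDerivAt.exists_lt_of_neg {ρ : E → ℝ} {ℓ : E →L[ℝ] ℝ} {p X : E}
    (hρ : HasStrictFDerivAt ρ ℓ p) (hX : ℓ X < 0) :
    ∃ c > 0, ∃ r > 0, ∀ x ∈ Metric.ball p r, ∀ s : ℝ, 0 < s → ∀ w : E, ‖w‖ ≤ c →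
      x + s • (X + w) ∈ Metric.ball p r → ρ (x + s • (X + w)) < ρ x := by
  set m := -ℓ X with hm
  have hm0 : 0 < m := by linarith
  set c := m / (4 * (‖ℓ‖ + 1)) with hc
  have hc0 : 0 < c := by positivity
  have hcl : ‖ℓ‖ * c ≤ m / 4 := by
    rw [hc, mul_div_assoc', div_le_div_iff₀ (by positivity) (by norm_num)]
    nlinarith [norm_nonneg ℓ]
  set ε := m / (4 * (‖X‖ + c)) with hε
  have hXc : 0 < ‖X‖ + c := by positivity
  have hε0 : 0 < ε := by positivity
  have hεX : ε * (‖X‖ + c) = m / 4 := by rw [hε]; field_simp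
  have h1 := hρ.isLittleO.def hε0
  rw [Metric.eventually_nhds_iff_ball] at h1
  obtain ⟨r, hr, hball⟩ := h1
  refine ⟨c, hc0, r, hr, fun x hx s hs w hw hxs => ?_⟩
  have h2 := hball (x + s • (X + w), x) (by
    rw [← ball_prod_same]; exact ⟨hxs, hx⟩)
  simp only [add_sub_cancel_left, map_smul, map_add, smul_eq_mul, norm_smul,
    Real.norm_of_nonneg hs.le] at h2
  have h3 : ‖X + w‖ ≤ ‖X‖ + c := (norm_add_le _ _).trans (by linarith)
  have h4 : ℓ w ≤ m / 4 :=
    ((le_abs_self _).trans (ℓ.le_opNorm w)).trans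
      ((mul_le_mul_of_nonneg_left hw (norm_nonneg _)).trans hcl)
  have h5 := (le_abs_self _).trans h2
  have h6 : ε * (s * ‖X + w‖) ≤ s * (m / 4) := by
    rw [← hεX]
    nlinarith [mul_le_mul_of_nonneg_left h3 (mul_pos hs hε0).le]
  nlinarith

/-- The increments of a map which is tangent to the identity, in the strict sense. -/
lemma HasStrictFDerivAt.exists_norm_sub_sub_le {H : E → E}
    (hH : HasStrictFDerivAt H (ContinuousLinearMap.id ℝ E) 0) (X : E) {κ : ℝ} (hκ : 0 < κ) :
    ∃ r > 0, ∀ w ∈ Metric.ball (0 : E) r, ∀ h : ℝ, |h| < r →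
      ‖H (w + h • X) - H w - h • X‖ ≤ κ * |h| := by
  have hε : 0 < κ / (‖X‖ + 1) := by positivity
  have h1 := hH.isLittleO.def hε
  rw [Metric.eventually_nhds_iff_ball] at h1
  obtain ⟨r, hr, hball⟩ := h1
  refine ⟨r / (‖X‖ + 2), by positivity, fun w hw h hh => ?_⟩
  have hX := norm_nonneg X
  have hr' : r / (‖X‖ + 2) * (‖X‖ + 2) = r := by field_simp
  have hq : 0 < r / (‖X‖ + 2) := by positivity
  have hw' : ‖w‖ < r / (‖X‖ + 2) := by simpa using hw
  have h2 := hball (w + h • X, w) (by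
    rw [← ball_prod_same]
    constructor
    · rw [mem_ball_zero_iff]
      refine (norm_add_le _ _).trans_lt ?_
      rw [norm_smul, Real.norm_eq_abs]
      nlinarith
    · rw [mem_ball_zero_iff]
      nlinarith)
  simp only [add_sub_cancel_left, ContinuousLinearMap.id_apply, norm_smul, Real.norm_eq_abs] at h2
  refine h2.trans ?_
  rw [div_mul_eq_mul_div, div_le_iff₀ (by positivity)]
  nlinarith [mul_nonneg hκ.le (abs_nonneg h)]

/-- **Interior cone property.** Moving in the direction `X`, transversal to the boundary and
pointing inwards, the distance to the complement grows at least linearly, at a rate that is uniform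
near the boundary point. -/
lemma exists_infDist_add_le {Ω : Set E} (hΩ : IsOpen Ω) {ρ : E → ℝ} {ℓ : E →L[ℝ] ℝ} {p X : E}
    (hρ : HasStrictFDerivAt ρ ℓ p) (hX : ℓ X < 0) (hp : p ∉ Ω)
    (hmem : ∀ᶠ x in 𝓝 p, (x ∈ Ω ↔ ρ x < 0)) :
    ∃ c > 0, ∃ r > 0, ∀ x ∈ Ω, x ∈ Metric.ball p r → ∀ s : ℝ, 0 ≤ s → s < r →
      x + s • X ∈ Ω ∧ Metric.infDist x Ωᶜ + c * s ≤ Metric.infDist (x + s • X) Ωᶜ := by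
  obtain ⟨c, hc, r₁, hr₁, hdesc⟩ := hρ.exists_lt_of_neg hX
  rw [Metric.eventually_nhds_iff_ball] at hmem
  obtain ⟨r₂, hr₂, hmem⟩ := hmem
  set R := min r₁ r₂ with hR
  have hR0 : 0 < R := lt_min hr₁ hr₂
  have hX0 := norm_nonneg X
  set r := R / (2 + (‖X‖ + c)) with hr
  have hr0 : 0 < r := by positivity
  have hrR : r * (2 + (‖X‖ + c)) = R := by rw [hr]; field_simp
  have hne : (Ωᶜ).Nonempty := ⟨p, hp⟩
  refine ⟨c, hc, r, hr0, fun x hx hxr s hs hsr => ?_⟩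
  have hd : 0 < Metric.infDist x Ωᶜ :=
    (hΩ.isClosed_compl.notMem_iff_infDist_pos hne).1 (by simpa using hx)
  set d := Metric.infDist x Ωᶜ with hdd
  have hdr : d < r := (Metric.infDist_le_dist_of_mem (s := Ωᶜ) hp).trans_lt hxr
  have key : d + c * s ≤ Metric.infDist (x + s • X) Ωᶜ := by
    rw [Metric.le_infDist hne]
    intro z hz
    by_contra! hlt
    rcases hs.eq_or_lt with rfl | hs0
    · rw [zero_smul, add_zero, mul_zero, add_zero] at hlt
      exact absurd (Metric.infDist_le_dist_of_mem hz) (not_le.2 hlt)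
    set T := d + c * s with hT
    have hT0 : 0 < T := by positivity
    -- split `z - (x + s • X)` into a part shorter than `d` and a part of size at most `c * s`
    set v := z - (x + s • X) with hv
    have hvT : ‖v‖ < T := by rw [hv, ← dist_eq_norm, dist_comm]; exact hlt
    set y := x + (d / T) • v with hy
    set w := (c / T) • v with hw
    have hyx : ‖y - x‖ < d := by
      rw [hy, add_sub_cancel_left, norm_smul, Real.norm_of_nonneg (by positivity),
        div_mul_eq_mul_div, div_lt_iff₀ hT0]
      exact mul_lt_mul_of_pos_left hvT hd
    have hwc : ‖w‖ ≤ c := by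
      rw [hw, norm_smul, Real.norm_of_nonneg (by positivity), div_mul_eq_mul_div,
        div_le_iff₀ hT0]
      exact mul_le_mul_of_nonneg_left hvT.le hc.le
    have hz' : z = y + s • (X + w) := by
      have h1 : d / T + s * (c / T) = 1 := by
        rw [hT]; field_simp
      have h2 : (d / T) • v + s • w = v := by
        rw [hw, smul_smul, ← add_smul, h1, one_smul]
      rw [hy, smul_add]
      calc z = x + s • X + v := by rw [hv]; abel
        _ = x + s • X + ((d / T) • v + s • w) := by rw [h2]
        _ = _ := by abel
    have hyΩ : y ∈ Ω := by
      by_contra hyΩ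
      have := Metric.infDist_le_dist_of_mem (x := x) (s := Ωᶜ) hyΩ
      rw [dist_comm, dist_eq_norm] at this
      exact absurd this (not_le.2 hyx)
    have hxp : ‖x - p‖ < r := mem_ball_iff_norm.1 hxr
    have hyp : ‖y - p‖ < 2 * r := by
      have := norm_sub_le_norm_sub_add_norm_sub y x p
      linarith
    have hXw : ‖X + w‖ ≤ ‖X‖ + c := (norm_add_le _ _).trans (by linarith)
    have hzp : ‖z - p‖ < R := by
      have h1 : ‖z - p‖ ≤ ‖y - p‖ + s * ‖X + w‖ := by
        rw [hz']
        calc ‖y + s • (X + w) - p‖ = ‖(y - p) + s • (X + w)‖ := by congr 1; abel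
          _ ≤ _ := (norm_add_le _ _).trans (by rw [norm_smul, Real.norm_of_nonneg hs])
      nlinarith [norm_nonneg (X + w)]
    have hyR : ‖y - p‖ < R := by nlinarith
    have hlt' := hdesc y (mem_ball_iff_norm.2 (hyR.trans_le (min_le_left _ _))) s hs0 w hwc
      (hz' ▸ mem_ball_iff_norm.2 (hzp.trans_le (min_le_left _ _)))
    rw [← hz'] at hlt'
    have hρy := (hmem y (mem_ball_iff_norm.2 (hyR.trans_le (min_le_right _ _)))).1 hyΩ
    exact hz ((hmem z (mem_ball_iff_norm.2 (hzp.trans_le (min_le_right _ _)))).2 (hlt'.trans hρy))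
  refine ⟨?_, key⟩
  by_contra hcon
  have h0 : Metric.infDist (x + s • X) Ωᶜ = 0 := Metric.infDist_zero_of_mem hcon
  nlinarith [mul_nonneg hc.le hs]

variable [CompleteSpace E]

/-- A level set of a submersion is, locally, parametrized by the kernel of its derivative, through
the restriction of a local diffeomorphism tangent to the identity. -/
lemma exists_levelSet_parametrization {ρ : E → ℝ} {p X : E} (hρ : ContDiffAt ℝ 1 ρ p)
    (hp : ρ p = 0) (hX : fderiv ℝ ρ p X ≠ 0) :
    ∃ g : E → E, ContDiffAt ℝ 1 g 0 ∧ g 0 = p ∧ HasFDerivAt g (ContinuousLinearMap.id ℝ E) 0 ∧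
      ∀ᶠ v in 𝓝 0, fderiv ℝ ρ p v = 0 → ρ (g v) = 0 := by
  set ℓ := fderiv ℝ ρ p with hℓ
  -- `F` straightens `ρ`: it satisfies `ℓ (F x) = ρ x`.
  set F : E → E := fun x => (x - p) + ((ρ x - ℓ (x - p)) * (ℓ X)⁻¹) • X with hF
  have hFp : F p = 0 := by simp [hF, hp]
  have hFc : ContDiffAt ℝ 1 F p := by
    have : ContDiffAt ℝ 1 (fun x => ℓ (x - p)) p :=
      (ℓ.contDiff.comp (contDiff_id.sub contDiff_const)).contDiffAt
    exact (contDiffAt_id.sub contDiffAt_const).add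
      (((hρ.sub this).mul contDiffAt_const).smul contDiffAt_const)
  have hFd : HasFDerivAt F ((ContinuousLinearEquiv.refl ℝ E : E ≃L[ℝ] E) : E →L[ℝ] E) p := by
    have h1 : HasFDerivAt (fun x => x - p) (ContinuousLinearMap.id ℝ E) p :=
      (hasFDerivAt_id p).sub_const p
    have h2 : HasFDerivAt ρ ℓ p := (hρ.differentiableAt one_ne_zero).hasFDerivAt
    have h3 : HasFDerivAt (fun x => ℓ (x - p)) (ℓ.comp (ContinuousLinearMap.id ℝ E)) p :=
      ℓ.hasFDerivAt.comp p h1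
    have h4 := h1.add (((h2.sub h3).mul_const (ℓ X)⁻¹).smul_const X)
    have h5 : ((ContinuousLinearEquiv.refl ℝ E : E ≃L[ℝ] E) : E →L[ℝ] E)
        = ContinuousLinearMap.id ℝ E
          + ((ℓ X)⁻¹ • (ℓ - ℓ.comp (ContinuousLinearMap.id ℝ E))).smulRight X := by
      ext v
      simp
    rw [h5]
    exact h4
  have hFs := hFc.hasStrictFDerivAt' hFd one_ne_zero
  refine ⟨hFs.localInverse F _ p, ?_, ?_, ?_, ?_⟩
  · rw [← hFp]; exact hFc.to_localInverse hFd one_ne_zero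
  · rw [← hFp]; exact hFs.localInverse_apply_image
  · have := hFs.to_localInverse.hasFDerivAt
    rw [hFp] at this
    simpa using this
  · have := hFs.eventually_right_inverse
    rw [hFp] at this
    filter_upwards [this] with v hv hℓv
    have h1 : ∀ x, ℓ (F x) = ρ x := by
      intro x
      simp only [hF, map_add, map_smul, smul_eq_mul]
      field_simp
      ring
    rw [← h1, hv, hℓv]

/-- Let `Γ` be a family of curves starting at the points of the hypersurface `S = {ρ = 0}` and
transversal to it at `p`. Then `w ↦ Γ (k w) (τ w)`, for a suitable "foot point" map `k` and a linear
time function `τ`, is a local diffeomorphism at `0`, tangent to the identity, which turns the lines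
of direction `X = deriv (Γ p) 0` into the curves of the family. -/
lemma exists_transversal_chart {S : Set E} {Γ : E → ℝ → E} {a : ℝ} {p X : E} {ρ : E → ℝ}
    (ha : 0 < a) (hXΓ : X = deriv (Γ p) 0)
    (hΓ : ContDiffWithinAt ℝ 1 (fun q : E × ℝ => Γ q.1 q.2) (S ×ˢ Ioo (-a) a) (p, 0))
    (hstart : ∀ q ∈ S, Γ q 0 = q) (hρ : ContDiffAt ℝ 1 ρ p) (hp : ρ p = 0)
    (hS : ∀ᶠ x in 𝓝 p, ρ x = 0 → x ∈ S) (hX : fderiv ℝ ρ p X ≠ 0) :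
    ∃ (τ : E →L[ℝ] ℝ) (k H : E → E), τ X = 1 ∧ k 0 = p ∧ ContinuousAt k 0 ∧
      (∀ w (h : ℝ), k (w + h • X) = k w) ∧ (∀ w, H w = Γ (k w) (τ w)) ∧
      (∀ᶠ w in 𝓝 0, k w ∈ S) ∧ HasStrictFDerivAt H (ContinuousLinearMap.id ℝ E) 0 := by
  obtain ⟨g, hg, hg0, hgd, hgS⟩ := exists_levelSet_parametrization hρ hp hX
  set ℓ := fderiv ℝ ρ p with hℓ
  set τ : E →L[ℝ] ℝ := (ℓ X)⁻¹ • ℓ with hτ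
  have hτX : τ X = 1 := by simp [hτ, hX]
  have hτℓ : ∀ w, ℓ (w - τ w • X) = 0 := by
    intro w
    simp only [hτ, map_sub, map_smul, smul_eq_mul, _root_.smul_apply]
    field_simp
    ring
  have hproj : ContDiff ℝ 1 fun w : E => w - τ w • X :=
    contDiff_id.sub (τ.contDiff.smul contDiff_const)
  set k : E → E := fun w => g (w - τ w • X) with hk
  have hk0 : k 0 = p := by simp [hk, hg0]
  have hkc : ContDiffAt ℝ 1 k 0 := by
    have h1 : ContDiffAt ℝ 1 g ((0 : E) - τ 0 • X) := by simpa using hg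
    exact h1.comp (0 : E) hproj.contDiffAt
  have hproj0 : Tendsto (fun w : E => w - τ w • X) (𝓝 0) (𝓝 0) := by
    have := hproj.continuous.tendsto 0
    simpa using this
  have hkS : ∀ᶠ w in 𝓝 0, k w ∈ S := by
    have h1 : Tendsto k (𝓝 0) (𝓝 p) := hk0 ▸ hkc.continuousAt
    filter_upwards [hproj0.eventually hgS, h1.eventually hS] with w hw1 hw2
    exact hw2 (hw1 (hτℓ w))
  set H : E → E := fun w => Γ (k w) (τ w) with hH
  have hHc : ContDiffAt ℝ 1 H 0 := by
    have h1 : ContDiffAt ℝ 1 (fun w : E => (k w, τ w)) 0 := hkc.prodMk τ.contDiff.contDiffAt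
    rw [← contDiffWithinAt_univ] at h1 ⊢
    refine hΓ.comp_of_preimage_mem_nhdsWithin_of_eq 0 h1 ?_ (by simp [hk0])
    rw [nhdsWithin_univ]
    have h2 : ∀ᶠ w : E in 𝓝 0, τ w ∈ Ioo (-a) a :=
      τ.continuous.continuousAt.eventually_mem (Ioo_mem_nhds (by simpa) (by simpa))
    filter_upwards [hkS, h2] with w hw1 hw2 using ⟨hw1, hw2⟩
  have hHs := hHc.hasStrictFDerivAt one_ne_zero
  have hcurve : ∀ v : E, HasDerivAt (fun s : ℝ => s • v) v 0 := fun v => by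
    simpa using (hasDerivAt_id (0 : ℝ)).smul_const v
  have hHv : ∀ v : E, HasDerivAt (fun s : ℝ => H (s • v)) (fderiv ℝ H 0 v) 0 := fun v => by
    have h1 : HasFDerivAt H (fderiv ℝ H 0) ((0 : ℝ) • v) := by
      rw [zero_smul]; exact hHs.hasFDerivAt
    exact h1.comp_hasDerivAt (0 : ℝ) (hcurve v)
  have hAX : fderiv ℝ H 0 X = X := by
    have h1 : (fun s : ℝ => H (s • X)) = Γ p := by
      ext1 s
      simp [hH, hk, hτX, hg0]
    have h2 := hHv X
    rw [h1] at h2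
    rw [← h2.deriv, ← hXΓ]
  have hAv : ∀ v, ℓ v = 0 → fderiv ℝ H 0 v = v := by
    intro v hv
    have hτv : τ v = 0 := by simp [hτ, hv]
    have h1 : HasDerivAt (fun s : ℝ => g (s • v)) v 0 := by
      have h1 : HasFDerivAt g (ContinuousLinearMap.id ℝ E) ((0 : ℝ) • v) := by
        rw [zero_smul]; exact hgd
      exact h1.comp_hasDerivAt (0 : ℝ) (hcurve v)
    have h2 : (fun s : ℝ => H (s • v)) =ᶠ[𝓝 0] fun s => g (s • v) := by
      have h3 : Tendsto (fun s : ℝ => s • v) (𝓝 0) (𝓝 0) := by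
        have := (hcurve v).continuousAt.tendsto
        rwa [zero_smul] at this
      filter_upwards [h3.eventually hkS] with s hs
      have h4 : k (s • v) = g (s • v) := by simp [hk, hτv]
      simp only [hH]
      rw [map_smul, hτv, smul_zero, hstart _ hs, h4]
    exact (hHv v).unique (h1.congr_of_eventuallyEq h2)
  have hA : fderiv ℝ H 0 = ContinuousLinearMap.id ℝ E := by
    ext1 w
    have h1 := hAv _ (hτℓ w)
    rw [map_sub, map_smul, hAX] at h1
    simpa using h1
  refine ⟨τ, k, H, hτX, hk0, hkc.continuousAt, fun w h => ?_, fun _ => rfl, hkS, hA ▸ hHs⟩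
  simp only [hk]
  congr 1
  rw [map_add, map_smul, hτX, smul_eq_mul, mul_one, add_smul]
  abel

end StrictDerivative

section TransversalFamily

variable {n : ℕ} {Ω : Set (EuclideanSpace ℝ (Fin n))} {a : ℝ}
  {Γ : EuclideanSpace ℝ (Fin n) → ℝ → EuclideanSpace ℝ (Fin n)}

/-- At a boundary point, the domain is given by a defining function that decreases in the direction
of the transversal curve. -/
lemma IsTransversalFamily.exists_definingFunction (hΩ : HasSmoothBoundary Ω)
    (hΓ : IsTransversalFamily Ω a Γ) {p : EuclideanSpace ℝ (Fin n)} (hp : p ∈ frontier Ω) :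
    ∃ ρ : EuclideanSpace ℝ (Fin n) → ℝ, ContDiffAt ℝ 1 ρ p ∧ ρ p = 0 ∧
      fderiv ℝ ρ p (deriv (Γ p) 0) < 0 ∧ (∀ᶠ x in 𝓝 p, (x ∈ Ω ↔ ρ x < 0)) ∧
      ∀ᶠ x in 𝓝 p, (x ∈ frontier Ω ↔ ρ x = 0) := by
  obtain ⟨V, ρ, h⟩ := hΩ p hp
  have hV : V ∈ 𝓝 p := h.isOpen.mem_nhds h.mem
  obtain ⟨c, hc, htr⟩ := hΓ.transversal
  have h1 := htr p hp _ ⟨V, ρ, h, rfl⟩ 0 ⟨by linarith [hΓ.pos], hΓ.pos⟩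
  have hgrad : 0 < ‖gradient ρ p‖ := norm_pos_iff.2 (h.gradient_ne_zero p h.mem)
  refine ⟨ρ, (h.contDiffOn.contDiffAt hV).of_le (by simp), (h.mem_frontier_iff p h.mem).1 hp, ?_,
    ?_, ?_⟩
  · rw [inner_smul_right] at h1
    have h2 : inner ℝ (deriv (Γ p) 0) (gradient ρ p) = fderiv ℝ ρ p (deriv (Γ p) 0) := by
      rw [real_inner_comm, gradient, InnerProductSpace.toDual_symm_apply]
    rw [h2] at h1
    by_contra! h3
    have : 0 ≤ ‖gradient ρ p‖⁻¹ * fderiv ℝ ρ p (deriv (Γ p) 0) := by positivity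
    linarith
  · filter_upwards [hV] with x hx using h.mem_iff x hx
  · filter_upwards [hV] with x hx using h.mem_frontier_iff x hx

/-- Near a boundary point, the family provides local coordinates in which its curves are parallel
lines. -/
lemma IsTransversalFamily.exists_chart (hΩ : HasSmoothBoundary Ω)
    (hΓ : IsTransversalFamily Ω a Γ) {p : EuclideanSpace ℝ (Fin n)} (hp : p ∈ frontier Ω) :
    ∃ (τ : EuclideanSpace ℝ (Fin n) →L[ℝ] ℝ)
      (k H : EuclideanSpace ℝ (Fin n) → EuclideanSpace ℝ (Fin n)),
      τ (deriv (Γ p) 0) = 1 ∧ k 0 = p ∧ ContinuousAt k 0 ∧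
      (∀ w (h : ℝ), k (w + h • deriv (Γ p) 0) = k w) ∧ (∀ w, H w = Γ (k w) (τ w)) ∧
      (∀ᶠ w in 𝓝 0, k w ∈ frontier Ω) ∧
      HasStrictFDerivAt H (ContinuousLinearMap.id ℝ (EuclideanSpace ℝ (Fin n))) 0 := by
  obtain ⟨ρ, hρ, hρp, hX, -, hfr⟩ := hΓ.exists_definingFunction hΩ hp
  refine exists_transversal_chart hΓ.pos rfl ?_ hΓ.start hρ hρp (hfr.mono fun x hx => hx.2) hX.ne
  exact (hΓ.contDiffOn (p, 0) ⟨hp, by linarith [hΓ.pos], hΓ.pos⟩).of_le (by norm_num)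

/-- The interior cone property in the direction of the transversal curve. -/
lemma IsTransversalFamily.exists_infDist_add_le (hΩo : IsOpen Ω) (hΩ : HasSmoothBoundary Ω)
    (hΓ : IsTransversalFamily Ω a Γ) {p : EuclideanSpace ℝ (Fin n)} (hp : p ∈ frontier Ω) :
    ∃ c > 0, ∃ r > 0, ∀ x ∈ Ω, x ∈ Metric.ball p r → ∀ s : ℝ, 0 ≤ s → s < r →
      x + s • deriv (Γ p) 0 ∈ Ω ∧
        Metric.infDist x Ωᶜ + c * s ≤ Metric.infDist (x + s • deriv (Γ p) 0) Ωᶜ := by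
  obtain ⟨ρ, hρ, hρp, hX, hmem, -⟩ := hΓ.exists_definingFunction hΩ hp
  exact _root_.exists_infDist_add_le hΩo (hρ.hasStrictFDerivAt one_ne_zero) hX
    (fun h => (hΩo.frontier_eq ▸ hp).2 h) hmem

/-- The curves of the family cover the part of `Ω` near a boundary point `p`, and increments along
them are, to first order, translations in the fixed direction `deriv (Γ p) 0`. -/
lemma IsTransversalFamily.exists_curve_through (hΩ : HasSmoothBoundary Ω)
    (hΓ : IsTransversalFamily Ω a Γ) {p : EuclideanSpace ℝ (Fin n)} (hp : p ∈ frontier Ω)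
    {κ ε : ℝ} (hκ : 0 < κ) (hε : 0 < ε) :
    ∃ r > 0, ∀ z ∈ Ω, z ∈ Metric.ball p r → ∃ q ∈ frontier Ω, ∃ t > 0, Γ q t = z ∧
      ∀ h : ℝ, 0 ≤ h → h < r → t + h < ε ∧
        ‖Γ q (t + h) - z - h • deriv (Γ p) 0‖ ≤ κ * h := by
  obtain ⟨ρ, hρ, hρp, hX, hmem, hfr⟩ := hΓ.exists_definingFunction hΩ hp
  obtain ⟨τ, k, H, hτX, hk0, hkc, hkX, hH, hkfr, hHd⟩ := hΓ.exists_chart hΩ hp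
  set X := deriv (Γ p) 0 with hXdef
  obtain ⟨c, hc, r₁, hr₁, hdesc⟩ := (hρ.hasStrictFDerivAt one_ne_zero).exists_lt_of_neg hX
  obtain ⟨r₂, hr₂, hinc⟩ := hHd.exists_norm_sub_sub_le X (lt_min hκ hc)
  have hH0 : H 0 = p := by rw [hH, hk0, map_zero, hΓ.start p hp]
  have hk : Tendsto k (𝓝 0) (𝓝 p) := by have := hkc.tendsto; rwa [hk0] at this
  have hHt : Tendsto H (𝓝 0) (𝓝 p) := by
    have := hHd.hasFDerivAt.continuousAt.tendsto; rwa [hH0] at this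
  have hτ : ∀ᶠ w in 𝓝 0, |τ w| < min r₂ (ε / 2) := by
    have h1 : Tendsto (fun w => |τ w|) (𝓝 0) (𝓝 0) := by
      have : Continuous fun w => |τ w| := by fun_prop
      simpa using this.tendsto 0
    exact h1.eventually_lt_const (lt_min hr₂ (by positivity))
  have hW : ∀ᶠ w in 𝓝 0, k w ∈ frontier Ω ∧ |τ w| < min r₂ (ε / 2) ∧ w ∈ Metric.ball 0 r₂ ∧
      H w ∈ Metric.ball p r₁ ∧ k w ∈ Metric.ball p r₁ ∧ (H w ∈ Ω ↔ ρ (H w) < 0) ∧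
      (k w ∈ frontier Ω ↔ ρ (k w) = 0) := by
    filter_upwards [hkfr, hτ, Metric.ball_mem_nhds 0 hr₂, hHt (Metric.ball_mem_nhds p hr₁),
      hk (Metric.ball_mem_nhds p hr₁), hHt.eventually hmem, hk.eventually hfr]
      with w h1 h2 h3 h4 h5 h6 h7 using ⟨h1, h2, h3, h4, h5, h6, h7⟩
  have hmap : map H (𝓝 0) = 𝓝 p := by
    rw [← hH0]
    exact HasStrictFDerivAt.map_nhds_eq_of_equiv
      (f' := ContinuousLinearEquiv.refl ℝ (EuclideanSpace ℝ (Fin n))) hHd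
  have himage := image_mem_map (m := H) hW
  rw [hmap, Metric.mem_nhds_iff] at himage
  obtain ⟨r₃, hr₃, hsub⟩ := himage
  refine ⟨min r₃ (min r₂ (ε / 2)), by positivity, fun z hz hzr => ?_⟩
  obtain ⟨w, ⟨hw1, hw2, hw3, hw4, hw5, hw6, hw7⟩, rfl⟩ :=
    hsub (Metric.ball_subset_ball (min_le_left _ _) hzr)
  have hρk : ρ (k w) = 0 := hw7.1 hw1
  have hρz : ρ (H w) < 0 := hw6.1 hz
  have hshift : ∀ h : ℝ, Γ (k w) (τ w + h) = H (w + h • X) := by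
    intro h
    rw [hH, hkX, map_add, map_smul, hτX, smul_eq_mul, mul_one]
  have ht : 0 < τ w := by
    by_contra! hle
    -- otherwise the foot point `k w` would be reached from `H w ∈ Ω` by moving inwards
    rcases hle.eq_or_lt with h0 | hlt
    · rw [hH, h0, hΓ.start _ hw1, hρk] at hρz
      exact lt_irrefl _ hρz
    · set s := -τ w with hs
      have hs0 : 0 < s := by linarith
      have h1 := hinc w hw3 s (by rw [hs, abs_neg]; exact hw2.trans_le (min_le_left _ _))
      rw [← hshift, hs, add_neg_cancel, hΓ.start _ hw1, ← hs, abs_of_pos hs0] at h1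
      set w' := s⁻¹ • (k w - H w - s • X) with hw'
      have h2 : k w = H w + s • (X + w') := by
        rw [hw', smul_add, smul_smul, mul_inv_cancel₀ hs0.ne', one_smul]
        abel
      have h3 : ‖w'‖ ≤ c := by
        rw [hw', norm_smul, norm_inv, Real.norm_of_nonneg hs0.le, inv_mul_le_iff₀ hs0, mul_comm]
        exact h1.trans (mul_le_mul_of_nonneg_right (min_le_right _ _) hs0.le)
      have h4 := hdesc (H w) hw4 s hs0 w' h3 (h2 ▸ hw5)
      rw [← h2, hρk] at h4
      linarith
  refine ⟨k w, hw1, τ w, ht, (hH w).symm, fun h hh0 hh => ⟨?_, ?_⟩⟩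
  · have h1 := hh.trans_le ((min_le_right _ _).trans (min_le_right _ _))
    have h2 := (le_abs_self _).trans_lt (hw2.trans_le (min_le_right _ _))
    linarith
  · have h1 := hinc w hw3 h (by
      rw [abs_of_nonneg hh0]; exact hh.trans_le ((min_le_right _ _).trans (min_le_left _ _)))
    rw [abs_of_nonneg hh0] at h1
    rw [hshift]
    exact h1.trans (mul_le_mul_of_nonneg_right (min_le_left _ _) hh0)

/-- The curves of the family enter the domain. -/
lemma IsTransversalFamily.eventually_mem (hΩ : HasSmoothBoundary Ω)
    (hΓ : IsTransversalFamily Ω a Γ) {p : EuclideanSpace ℝ (Fin n)} (hp : p ∈ frontier Ω) :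
    (∀ᶠ t in 𝓝[>] 0, Γ p t ∈ Ω) ∧ Tendsto (Γ p) (𝓝[>] 0) (𝓝 p) := by
  obtain ⟨ρ, hρ, hρp, hX, hmem, hfr⟩ := hΓ.exists_definingFunction hΩ hp
  obtain ⟨τ, k, H, hτX, hk0, hkc, hkX, hH, hkfr, hHd⟩ := hΓ.exists_chart hΩ hp
  set X := deriv (Γ p) 0 with hXdef
  have hΓH : (fun t : ℝ => H (t • X)) = Γ p := by
    ext1 t
    have := hkX 0 t
    rw [zero_add, hk0] at this
    rw [hH, this, map_smul, hτX, smul_eq_mul, mul_one]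
  have hd : HasDerivAt (Γ p) X 0 := by
    rw [← hΓH]
    have h1 : HasDerivAt (fun s : ℝ => s • X) X 0 := by
      simpa using (hasDerivAt_id (0 : ℝ)).smul_const X
    have h2 : HasFDerivAt H (ContinuousLinearMap.id ℝ _) ((0 : ℝ) • X) := by
      rw [zero_smul]; exact hHd.hasFDerivAt
    exact h2.comp_hasDerivAt (0 : ℝ) h1
  have ht : Tendsto (Γ p) (𝓝 0) (𝓝 p) := by
    have := hd.continuousAt.tendsto
    rwa [hΓ.start p hp] at this
  have htr := ht.mono_left (nhdsWithin_le_nhds (s := Ioi 0))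
  refine ⟨?_, htr⟩
  have hdρ : HasDerivAt (fun t => ρ (Γ p t)) (fderiv ℝ ρ p X) 0 := by
    have h1 : HasFDerivAt ρ (fderiv ℝ ρ p) (Γ p 0) := by
      rw [hΓ.start p hp]; exact (hρ.differentiableAt one_ne_zero).hasFDerivAt
    exact h1.comp_hasDerivAt (0 : ℝ) hd
  have hslope := (hasDerivAt_iff_tendsto_slope.1 hdρ).mono_left
    (nhdsWithin_mono 0 fun t (ht : 0 < t) => ht.ne')
  filter_upwards [hslope.eventually_lt_const hX, htr.eventually hmem, self_mem_nhdsWithin]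
    with t h1 h2 h3
  refine h2.2 ?_
  rw [slope_def_field, hΓ.start p hp, hρp, sub_zero, sub_zero, div_neg_iff] at h1
  rcases h1 with h1 | h1
  · exact absurd h1.2 (not_lt.2 (le_of_lt h3))
  · exact h1.1

end TransversalFamily

end Geometry

/-! ### Majorants -/

section Majorants

variable {B : ℝ → ℝ}

lemma IsMajorant.div_le_div (hB : IsMajorant B) {s t : ℝ} (hs : 0 < s) (hst : s ≤ t) :
    B t / t ≤ B s / s :=
  hB.antitoneOn_div hs (hs.trans_le hst) hst

lemma IsMajorant.div_nonneg (hB : IsMajorant B) {t : ℝ} (ht : 0 < t) : 0 ≤ B t / t :=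
  _root_.div_nonneg (hB.nonneg t ht.le) ht.le

lemma IsMajorant.mono (hB : IsMajorant B) {s t : ℝ} (hs : 0 ≤ s) (hst : s ≤ t) : B s ≤ B t :=
  hB.monotoneOn hs (hs.trans hst) hst

/-- A majorant is doubling, because `B t / t` is non-increasing. -/
lemma IsMajorant.two_mul_le (hB : IsMajorant B) {t : ℝ} (ht : 0 ≤ t) : B (2 * t) ≤ 2 * B t := by
  rcases ht.eq_or_lt with rfl | ht
  · simp [hB.map_zero]
  · have h1 := hB.div_le_div ht (by linarith : t ≤ 2 * t)
    rw [div_le_div_iff₀ (by positivity) ht] at h1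
    nlinarith

lemma IsMajorant.div_half_le (hB : IsMajorant B) {t : ℝ} (ht : 0 < t) :
    B (t / 2) / (t / 2) ≤ 2 * (B t / t) := by
  have h1 := hB.mono (by positivity : 0 ≤ t / 2) (by linarith : t / 2 ≤ t)
  rw [div_div_eq_mul_div, mul_comm (B (t / 2)), mul_div_assoc]
  gcongr

/-- A majorant vanishes either identically or only at the origin. -/
lemma IsMajorant.eq_zero_or_pos (hB : IsMajorant B) :
    (∀ t, 0 ≤ t → B t = 0) ∨ ∀ t, 0 < t → 0 < B t := by
  by_cases h : ∃ t, 0 < t ∧ B t = 0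
  · obtain ⟨t₀, ht₀, h0⟩ := h
    refine Or.inl fun t ht => ?_
    rcases le_total t t₀ with htt | htt
    · exact le_antisymm (h0 ▸ hB.mono ht htt) (hB.nonneg t ht)
    · have h1 := hB.div_le_div ht₀ htt
      have ht' : 0 < t := ht₀.trans_le htt
      rw [h0, zero_div, div_le_iff₀ ht', zero_mul] at h1
      exact le_antisymm h1 (hB.nonneg t ht)
  · push Not at h
    exact Or.inr fun t ht => (hB.nonneg t ht.le).lt_of_ne' (h t ht)

/-- Constants are dominated by `B t / t` on bounded intervals. -/
lemma IsMajorant.const_le_mul_div (hB : IsMajorant B) (hpos : ∀ t, 0 < t → 0 < B t) {M D t : ℝ}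
    (hM : 0 ≤ M) (ht : 0 < t) (htD : t ≤ D) : M ≤ M * (D / B D) * (B t / t) := by
  have hD : 0 < D := ht.trans_le htD
  have h1 := hB.div_le_div ht htD
  have h2 := hpos D hD
  have h3 : D / B D * (B D / D) = 1 := by field_simp
  calc M = M * (D / B D * (B D / D)) := by rw [h3, mul_one]
    _ ≤ M * (D / B D * (B t / t)) := by gcongr
    _ = _ := by ring

/-- Comparison of the sum of `B t / t` along a geometric progression with `∫ B t / t ^ 2`. -/
lemma IsMajorant.sum_geometric_le (hB : IsMajorant B) {c e : ℝ} (hc : 0 < c) (he : 0 < e)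
    (hint : IntegrableOn (fun t => B t / t ^ 2) (Ioi e)) (K : ℕ) :
    ∑ k ∈ Finset.range K, B ((1 + c) ^ k * e) / ((1 + c) ^ k * e)
      ≤ (1 + c) ^ 2 / c * ∫ t in Ioi e, B t / t ^ 2 := by
  have hpow : ∀ k : ℕ, 1 ≤ (1 + c) ^ k := fun k => one_le_pow₀ (by linarith)
  have hle : ∀ k : ℕ, e ≤ (1 + c) ^ k * e := fun k => by nlinarith [hpow k]
  have hmono : ∀ k : ℕ, (1 + c) ^ k * e ≤ (1 + c) ^ (k + 1) * e := fun k => by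
    rw [pow_succ]; nlinarith [hpow k, mul_pos (mul_pos (lt_of_lt_of_le one_pos (hpow k)) he) hc]
  have hsub : ∀ k : ℕ, Ioc e ((1 + c) ^ k * e) ⊆ Ioi e := fun k t ht => ht.1
  have hnn : ∀ t ∈ Ioi e, 0 ≤ B t / t ^ 2 := fun t ht =>
    _root_.div_nonneg (hB.nonneg t (he.trans ht).le) (sq_nonneg t)
  have key : ∑ k ∈ Finset.range K, B ((1 + c) ^ k * e) / ((1 + c) ^ k * e)
      ≤ (1 + c) ^ 2 / c * ∫ t in Ioc e ((1 + c) ^ K * e), B t / t ^ 2 := by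
    induction K with
    | zero => simp
    | succ K ih =>
      set s := (1 + c) ^ K * e with hs
      have hs0 : 0 < s := he.trans_le (hle K)
      have hs1 : (1 + c) ^ (K + 1) * e = (1 + c) * s := by rw [hs, pow_succ]; ring
      have hsplit : Ioc e ((1 + c) ^ (K + 1) * e) = Ioc e s ∪ Ioc s ((1 + c) * s) := by
        rw [← hs1, Ioc_union_Ioc_eq_Ioc (hle K) (hmono K)]
      have hi1 : IntegrableOn (fun t => B t / t ^ 2) (Ioc e s) := hint.mono_set (hsub K)
      have hi2 : IntegrableOn (fun t => B t / t ^ 2) (Ioc s ((1 + c) * s)) :=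
        hint.mono_set fun t ht => (hle K).trans_lt ht.1
      rw [Finset.sum_range_succ, hsplit, setIntegral_union (Ioc_disjoint_Ioc_of_le le_rfl)
        measurableSet_Ioc hi1 hi2, mul_add]
      refine add_le_add ih ?_
      have h1 : ∫ _ in Ioc s ((1 + c) * s), B s / ((1 + c) * s) ^ 2
          ≤ ∫ t in Ioc s ((1 + c) * s), B t / t ^ 2 := by
        refine setIntegral_mono_on (integrableOn_const (by simp)) hi2 measurableSet_Ioc
          fun t ht => ?_
        have ht0 : 0 < t := hs0.trans ht.1
        have h2 := hB.mono hs0.le ht.1.le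
        have h3 := hB.nonneg t ht0.le
        have h4 := ht.2
        gcongr
      rw [setIntegral_const, Real.volume_real_Ioc_of_le (by nlinarith), smul_eq_mul] at h1
      calc B s / s = (1 + c) ^ 2 / c * (((1 + c) * s - s) * (B s / ((1 + c) * s) ^ 2)) := by
            field_simp
            ring
        _ ≤ _ := by gcongr
  refine key.trans (mul_le_mul_of_nonneg_left ?_ (by positivity))
  exact setIntegral_mono_set hint
    ((ae_restrict_iff' measurableSet_Ioi).2 (Eventually.of_forall hnn)) (hsub K).eventuallyLE

/-- The two integrals in the definition of a regular majorant, bounded separately. -/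
lemma IsRegularMajorant.exists_integral_le (hB : IsRegularMajorant B) :
    ∃ C > 0, ∃ δ₀ > 0, ∀ δ, 0 < δ → δ < δ₀ →
      IntegrableOn (fun t => B t / t) (Ioc 0 δ) ∧ ∫ t in Ioc 0 δ, B t / t ≤ C * B δ ∧
      IntegrableOn (fun t => B t / t ^ 2) (Ioi δ) ∧
      ∫ t in Ioi δ, B t / t ^ 2 ≤ C * (B δ / δ) := by
  obtain ⟨C, hC, δ₀, hδ₀, h⟩ := hB.regular
  refine ⟨C, hC, δ₀, hδ₀, fun δ hδ hδ' => ?_⟩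
  obtain ⟨h1, h2, h3⟩ := h δ hδ hδ'
  have h4 : 0 ≤ ∫ t in Ioc 0 δ, B t / t :=
    setIntegral_nonneg measurableSet_Ioc fun t ht => hB.div_nonneg ht.1
  have h5 : 0 ≤ ∫ t in Ioi δ, B t / t ^ 2 :=
    setIntegral_nonneg measurableSet_Ioi fun t ht =>
      _root_.div_nonneg (hB.nonneg t (hδ.trans ht).le) (sq_nonneg t)
  refine ⟨h1, by nlinarith, h2, ?_⟩
  rw [mul_div_assoc', le_div_iff₀ hδ]
  nlinarith

/-- Geometric sums of `B t / t` are controlled by their first term if `B` is regular. -/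
lemma IsRegularMajorant.exists_sum_geometric_le (hB : IsRegularMajorant B) {c : ℝ} (hc : 0 < c) :
    ∃ C > 0, ∃ δ₀ > 0, ∀ e, 0 < e → e < δ₀ → ∀ K : ℕ,
      ∑ k ∈ Finset.range K, B ((1 + c) ^ k * e) / ((1 + c) ^ k * e) ≤ C * (B e / e) := by
  obtain ⟨C, hC, δ₀, hδ₀, h⟩ := hB.exists_integral_le
  refine ⟨(1 + c) ^ 2 / c * C, by positivity, δ₀, hδ₀, fun e he he' K => ?_⟩
  obtain ⟨-, -, h2, h3⟩ := h e he he'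
  refine (hB.sum_geometric_le hc he h2 K).trans ?_
  rw [mul_assoc]
  exact mul_le_mul_of_nonneg_left h3 (by positivity)

/-- The square root is a regular majorant. -/
lemma isRegularMajorant_sqrt : IsRegularMajorant Real.sqrt where
  continuousOn := Real.continuous_sqrt.continuousOn
  nonneg t _ := Real.sqrt_nonneg t
  map_zero := Real.sqrt_zero
  monotoneOn s _ t _ h := Real.sqrt_le_sqrt h
  antitoneOn_div := by
    intro s hs t ht hst
    simp only [Real.sqrt_div_self']
    exact one_div_le_one_div_of_le (Real.sqrt_pos.2 hs) (Real.sqrt_le_sqrt hst)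
  regular := by
    refine ⟨4, by norm_num, 1, one_pos, fun δ hδ _ => ?_⟩
    have h1 : EqOn (fun t => Real.sqrt t / t) (fun t => t ^ (-(1 / 2) : ℝ)) (Ioc 0 δ) := by
      intro t ht
      simp only
      rw [Real.sqrt_eq_rpow, ← Real.rpow_sub_one ht.1.ne']
      norm_num
    have h2 : EqOn (fun t => Real.sqrt t / t ^ 2) (fun t => t ^ (-(3 / 2) : ℝ)) (Ioi δ) := by
      intro t ht
      have ht0 : 0 < t := hδ.trans ht
      simp only
      rw [Real.sqrt_eq_rpow, ← Real.rpow_sub_natCast ht0.ne']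
      norm_num
    have hi1 : IntegrableOn (fun t : ℝ => t ^ (-(1 / 2) : ℝ)) (Ioc 0 δ) :=
      (intervalIntegrable_iff_integrableOn_Ioc_of_le hδ.le).1
        (intervalIntegral.intervalIntegrable_rpow' (by norm_num))
    have hi2 : IntegrableOn (fun t : ℝ => t ^ (-(3 / 2) : ℝ)) (Ioi δ) :=
      integrableOn_Ioi_rpow_of_lt (by norm_num) hδ
    refine ⟨hi1.congr_fun h1.symm measurableSet_Ioc, hi2.congr_fun h2.symm measurableSet_Ioi, ?_⟩
    rw [setIntegral_congr_fun measurableSet_Ioc h1, setIntegral_congr_fun measurableSet_Ioi h2,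
      integral_Ioi_rpow_of_lt (by norm_num) hδ, ← intervalIntegral.integral_of_le hδ.le,
      integral_rpow (Or.inl (by norm_num))]
    have h3 : δ * δ ^ (-(3 / 2) + 1 : ℝ) = Real.sqrt δ := by
      rw [Real.sqrt_eq_rpow, ← Real.rpow_one_add' hδ.le (by norm_num)]
      norm_num
    have h4 : δ ^ (-(1 / 2) + 1 : ℝ) = Real.sqrt δ := by
      rw [Real.sqrt_eq_rpow]; norm_num
    have h5 : (0 : ℝ) ^ (-(1 / 2) + 1 : ℝ) = 0 := Real.zero_rpow (by norm_num)
    rw [h4, h5]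
    have h6 : δ * (-δ ^ (-(3 / 2) + 1 : ℝ) / (-(3 / 2) + 1))
        = (δ * δ ^ (-(3 / 2) + 1 : ℝ)) * 2 := by ring
    have h7 : (Real.sqrt δ - 0) / (-(1 / 2) + 1) = Real.sqrt δ * 2 := by ring
    rw [h6, h3, h7]
    linarith

end Majorants

/-! ### The gradient estimate -/

section GradientEstimate

open InnerProductSpace Laplacian

variable {E : Type*} [NormedAddCommGroup E]

lemma mem_of_infDist_compl_pos {Ω : Set E} {x : E} (h : 0 < Metric.infDist x Ωᶜ) : x ∈ Ω := by
  by_contra hx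
  exact h.ne' (Metric.infDist_zero_of_mem hx)

lemma infDist_compl_sub_le (Ω : Set E) (x y : E) :
    Metric.infDist x Ωᶜ - ‖y - x‖ ≤ Metric.infDist y Ωᶜ := by
  have := Metric.infDist_le_infDist_add_dist (s := Ωᶜ) (x := x) (y := y)
  rw [dist_comm, dist_eq_norm] at this
  linarith

section Normed

variable [NormedSpace ℝ E]

/-- `‖∇u‖ ≤ N * B d_τ / d_τ`, where `d_τ = dist (·, Ωᶜ) - τ`, at all points where `d_τ > 0`. -/
def GradientBound (B : ℝ → ℝ) (Ω : Set E) (u : E → ℝ) (τ N : ℝ) : Prop :=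
  ∀ x, τ < Metric.infDist x Ωᶜ → ‖fderiv ℝ u x‖ ≤
    N * (B (Metric.infDist x Ωᶜ - τ) / (Metric.infDist x Ωᶜ - τ))

/-- The function `u` satisfies, near `p`, the Lipschitz condition along curves that are tangent up
to an error `κ` to the direction `X`. -/
def NearlyTranslationLipschitz (B : ℝ → ℝ) (Ω : Set E) (u : E → ℝ) (p X : E) (C κ r : ℝ) : Prop :=
  ∀ z ∈ Ω, z ∈ Metric.ball p r → ∀ h : ℝ, 0 < h → h < r → ∃ z' : E, ‖z' - (z + h • X)‖ ≤ κ * h ∧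
    (z' ∈ Ω → |u z' - u z| ≤ C * B h)

/-- The cone property in the direction `X` near `p`, at rate `c`. -/
def ConeProperty (Ω : Set E) (p X : E) (c r : ℝ) : Prop :=
  ∀ x ∈ Ω, x ∈ Metric.ball p r → ∀ s : ℝ, 0 ≤ s → s < r →
    x + s • X ∈ Ω ∧ Metric.infDist x Ωᶜ + c * s ≤ Metric.infDist (x + s • X) Ωᶜ

/-- A function with a gradient bound is Lipschitz on small balls. -/
lemma GradientBound.abs_sub_le {B : ℝ → ℝ} (hB : IsMajorant B) {Ω : Set E} {u : E → ℝ} {τ N : ℝ}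
    (h : GradientBound B Ω u τ N) (hN : 0 ≤ N) (hτ : 0 ≤ τ)
    (hu : ∀ x ∈ Ω, DifferentiableAt ℝ u x) {x y : E} {e : ℝ} (he : 0 < e)
    (hx : τ + e + ‖y - x‖ ≤ Metric.infDist x Ωᶜ) :
    |u y - u x| ≤ N * (B e / e) * ‖y - x‖ := by
  have hd : ∀ z ∈ Metric.closedBall x ‖y - x‖, τ + e ≤ Metric.infDist z Ωᶜ := by
    intro z hz
    have := infDist_compl_sub_le Ω x z
    have := mem_closedBall_iff_norm.1 hz
    linarith
  refine (convex_closedBall x ‖y - x‖).norm_image_sub_le_of_norm_fderiv_le (𝕜 := ℝ)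
    (fun z hz => hu z (mem_of_infDist_compl_pos (by linarith [hd z hz]))) (fun z hz => ?_)
    (Metric.mem_closedBall_self (norm_nonneg _)) (mem_closedBall_iff_norm.2 le_rfl)
  have h1 := hd z hz
  refine (h z (by linarith)).trans (mul_le_mul_of_nonneg_left ?_ hN)
  exact hB.div_le_div he (by linarith)

end Normed

variable [InnerProductSpace ℝ E] [FiniteDimensional ℝ E]

/-- Translates of harmonic functions are harmonic. -/
lemma InnerProductSpace.HarmonicAt.comp_add_right {u : E → ℝ} {x v : E} (h : HarmonicAt u (x + v)) :
    HarmonicAt (fun z => u (z + v)) x := by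
  have ht : Tendsto (fun z : E => z + v) (𝓝 x) (𝓝 (x + v)) :=
    (continuous_id.add continuous_const).tendsto x
  refine ⟨h.1.comp x (contDiffAt_id.add contDiffAt_const), ?_⟩
  filter_upwards [ht.eventually h.2] with z hz
  rw [laplacian_eq_iteratedFDeriv_stdOrthonormalBasis] at hz ⊢
  simp only [iteratedFDeriv_comp_add_right]
  exact hz

/-- The gradient of a harmonic function is bounded on compact subsets. -/
lemma InnerProductSpace.HarmonicOnNhd.exists_norm_fderiv_le {u : E → ℝ} {Ω K : Set E}
    (hΩ : IsOpen Ω) (hu : HarmonicOnNhd u Ω) (hK : IsCompact K) (hKΩ : K ⊆ Ω) :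
    ∃ M, 0 ≤ M ∧ ∀ x ∈ K, ‖fderiv ℝ u x‖ ≤ M := by
  have h1 : ContinuousOn (fderiv ℝ u) Ω :=
    hu.contDiffOn.continuousOn_fderiv_of_isOpen hΩ (by norm_num)
  obtain ⟨M, hM⟩ := hK.exists_bound_of_continuousOn (h1.mono hKΩ)
  exact ⟨max M 0, le_max_right _ _, fun x hx => (hM x hx).trans (le_max_left _ _)⟩

variable [MeasurableSpace E] [BorelSpace E]

variable (E) in
/-- One step of the descent from the interior to the boundary. The difference
`z ↦ u (z + e • X) - u z` is harmonic, and small because of the Lipschitz condition along the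
curves; hence its gradient is small as well. -/
lemma exists_norm_fderiv_sub_le :
    ∃ G > 0, ∀ (B : ℝ → ℝ) (Ω : Set E) (u : E → ℝ) (p X y : E) (c C κ r τ N e : ℝ),
      IsMajorant B → HarmonicOnNhd u Ω → 0 ≤ c → 0 ≤ κ → κ ≤ 1 / 4 → 0 ≤ τ → 0 ≤ N → 0 ≤ C →
      ConeProperty Ω p X c r → NearlyTranslationLipschitz B Ω u p X C κ r →
      GradientBound B Ω u τ N → ‖y - p‖ < r / 2 → 0 < e → e < r / 2 →
      τ + e ≤ Metric.infDist y Ωᶜ →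
      ‖fderiv ℝ u (y + e • X) - fderiv ℝ u y‖ ≤ G * (C + 2 * κ * N) * (B e / e) := by
  obtain ⟨G, hG, hgrad⟩ := exists_norm_fderiv_le_of_harmonic (E := E)
  refine ⟨4 * G, by positivity, ?_⟩
  intro B Ω u p X y c C κ r τ N e hB hu hc hκ hκ' hτ hN hC hcone htr hbd hyp he her hyd
  have hdiff : ∀ x ∈ Ω, DifferentiableAt ℝ u x := fun x hx => (hu x hx).1.differentiableAt (by simp)
  have hball : ∀ z ∈ Metric.ball y (e / 4), z ∈ Ω ∧ z ∈ Metric.ball p r ∧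
      τ + 3 * e / 4 ≤ Metric.infDist z Ωᶜ := by
    intro z hz
    have h1 := mem_ball_iff_norm.1 hz
    have h2 := infDist_compl_sub_le Ω y z
    have h3 : τ + 3 * e / 4 ≤ Metric.infDist z Ωᶜ := by linarith
    refine ⟨mem_of_infDist_compl_pos (by linarith), mem_ball_iff_norm.2 ?_, h3⟩
    linarith [norm_sub_le_norm_sub_add_norm_sub z y p]
  have hshift : ∀ z ∈ Metric.ball y (e / 4), z + e • X ∈ Ω ∧
      τ + 3 * e / 4 ≤ Metric.infDist (z + e • X) Ωᶜ := by
    intro z hz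
    obtain ⟨h1, h2, h3⟩ := hball z hz
    obtain ⟨h4, h5⟩ := hcone z h1 h2 e he.le (by linarith)
    exact ⟨h4, by nlinarith⟩
  set v : E → ℝ := (fun z => u (z + e • X)) - u with hv
  have hvh : HarmonicOnNhd v (Metric.ball y (e / 4)) := fun z hz =>
    (HarmonicAt.comp_add_right (hu _ (hshift z hz).1)).sub (hu z (hball z hz).1)
  have hvb : ∀ z ∈ Metric.ball y (e / 4), |v z| ≤ (C + 2 * κ * N) * B e := by
    intro z hz
    obtain ⟨h1, h2, h3⟩ := hball z hz
    obtain ⟨h4, h5⟩ := hshift z hz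
    obtain ⟨z', hz'1, hz'2⟩ := htr z h1 h2 e he (by linarith)
    have hκe : κ * e ≤ e / 4 := by nlinarith
    have h6 : |u z' - u (z + e • X)| ≤ N * (B (e / 2) / (e / 2)) * ‖z' - (z + e • X)‖ :=
      hbd.abs_sub_le hB hN hτ hdiff (by positivity) (by linarith)
    have h7 : z' ∈ Ω := mem_of_infDist_compl_pos (by
      linarith [infDist_compl_sub_le Ω (z + e • X) z'])
    have h8 : |u z' - u (z + e • X)| ≤ 2 * κ * N * B e := by
      have h9 := hB.div_half_le he
      have h10 := hB.div_nonneg he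
      calc _ ≤ N * (B (e / 2) / (e / 2)) * ‖z' - (z + e • X)‖ := h6
        _ ≤ N * (2 * (B e / e)) * (κ * e) := by gcongr
        _ = 2 * κ * N * B e := by field_simp
    have h9 : v z = (u z' - u z) - (u z' - u (z + e • X)) := by
      simp only [hv, Pi.sub_apply]; ring
    rw [h9]
    calc _ ≤ |u z' - u z| + |u z' - u (z + e • X)| := abs_sub _ _
      _ ≤ C * B e + 2 * κ * N * B e := add_le_add (hz'2 h7) h8
      _ = _ := by ring
  have hmem : y ∈ Metric.ball y (e / 4) := Metric.mem_ball_self (by positivity)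
  have h1 := hgrad v y (e / 4) _ (by positivity) hvh hvb
  have h2 : fderiv ℝ v y = fderiv ℝ u (y + e • X) - fderiv ℝ u y := by
    rw [hv, fderiv_sub, fderiv_comp_add_right]
    · exact (hdiff _ (hshift y hmem).1).comp y (by fun_prop)
    · exact hdiff y (hball y hmem).1
  rw [h2] at h1
  refine h1.trans (le_of_eq ?_)
  field_simp

/-- Self-improvement of the gradient bound near a boundary point: descending to `x` from a point at
a fixed distance from the boundary, in geometrically decreasing steps in the direction `X`, the
increments of the gradient add up to a fraction of the gradient bound one started with. -/
lemma exists_norm_fderiv_le_near_boundary {B : ℝ → ℝ} (hB : IsRegularMajorant B)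
    (hpos : ∀ t, 0 < t → 0 < B t) {Ω : Set E} (hΩ : IsOpen Ω) {u : E → ℝ}
    (hu : HarmonicOnNhd u Ω) {p X : E} (hp : p ∉ Ω) {c r₀ C : ℝ} (hc : 0 < c) (hr₀ : 0 < r₀)
    (hC : 0 ≤ C) (hcone : ConeProperty Ω p X c r₀)
    (htr : ∀ κ > 0, ∃ r > 0, NearlyTranslationLipschitz B Ω u p X C κ r) :
    ∃ A, 0 ≤ A ∧ ∃ ρ > 0, ∀ τ > 0, ∀ N, 0 ≤ N → GradientBound B Ω u τ N → ∀ x ∈ Metric.ball p ρ,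
      τ < Metric.infDist x Ωᶜ → ‖fderiv ℝ u x‖ ≤
        (A + N / 2) * (B (Metric.infDist x Ωᶜ - τ) / (Metric.infDist x Ωᶜ - τ)) := by
  obtain ⟨G, hG, hstep⟩ := exists_norm_fderiv_sub_le E
  obtain ⟨S, hS, δ₀, hδ₀, hsum⟩ := hB.exists_sum_geometric_le hc
  -- the error `κ` makes the coefficient `2 * G * κ * S` of `N` equal to at most `1 / 2`
  set κ := min (1 / 4) (1 / (4 * G * S)) with hκ
  have hκ0 : 0 < κ := by positivity
  have hκGS : G * (2 * κ) * S ≤ 1 / 2 := by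
    have h1 : κ ≤ 1 / (4 * G * S) := min_le_right _ _
    rw [le_div_iff₀ (by positivity)] at h1
    linarith
  obtain ⟨r₁, hr₁, htr⟩ := htr κ hκ0
  set r := min r₀ r₁ with hr
  have hr0 : 0 < r := lt_min hr₀ hr₁
  have hcone' : ConeProperty Ω p X c r := fun x hx hxp s hs hsr =>
    hcone x hx (Metric.ball_subset_ball (min_le_left _ _) hxp) s hs (hsr.trans_le (min_le_left _ _))
  have htr' : NearlyTranslationLipschitz B Ω u p X C κ r := fun z hz hzp h hh hhr =>
    htr z hz (Metric.ball_subset_ball (min_le_right _ _) hzp) h hh (hhr.trans_le (min_le_right _ _))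
  have hX := norm_nonneg X
  set Λ := 1 + (1 + c) / c * (1 + ‖X‖) with hΛ
  have hΛ1 : 1 ≤ Λ := by rw [hΛ]; exact le_add_of_nonneg_right (by positivity)
  -- the descent starts at a point whose distance to the boundary is at least `ρ`
  set ρ := min (δ₀ / 2) (r / (4 * Λ)) with hρ
  have hρ0 : 0 < ρ := by positivity
  have hρΛ : ρ * Λ ≤ r / 4 := by
    have h1 : ρ ≤ r / (4 * Λ) := min_le_right _ _
    rw [le_div_iff₀ (by positivity)] at h1
    linarith
  have hρδ : ρ < δ₀ := (min_le_left _ _).trans_lt (by linarith)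
  have hK : IsCompact (Metric.closedBall p r ∩ {y | ρ ≤ Metric.infDist y Ωᶜ}) :=
    (isCompact_closedBall p r).inter_right
      (isClosed_le continuous_const (Metric.continuous_infDist_pt _))
  obtain ⟨M, hM0, hM⟩ := HarmonicOnNhd.exists_norm_fderiv_le hΩ hu hK
    fun y hy => mem_of_infDist_compl_pos (hρ0.trans_le hy.2)
  have hρB := hpos ρ hρ0
  refine ⟨M * (ρ / B ρ) + G * C * S, by positivity, ρ, hρ0, fun τ hτ N hN hbd x hxp hxτ => ?_⟩
  set e := Metric.infDist x Ωᶜ - τ with he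
  have he0 : 0 < e := by linarith
  have hxp' : ‖x - p‖ < ρ := mem_ball_iff_norm.1 hxp
  have heρ : e < ρ := by
    have := Metric.infDist_le_dist_of_mem (s := Ωᶜ) (x := x) hp
    rw [dist_eq_norm] at this
    linarith
  have hxΩ : x ∈ Ω := mem_of_infDist_compl_pos (by linarith)
  have hρr : ρ ≤ r / 4 := by nlinarith
  have hxr : x ∈ Metric.ball p r := mem_ball_iff_norm.2 (by linarith)
  set q : ℕ → ℝ := fun k => (1 + c) ^ k with hq
  have hq1 : ∀ k, 1 ≤ q k := fun k => one_le_pow₀ (by linarith)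
  have hqs : ∀ k, q (k + 1) = (1 + c) * q k := fun k => by simp only [hq, pow_succ]; ring
  set y : ℕ → E := fun k => x + ((q k * e - e) / c) • X with hy
  have hys : ∀ k, y (k + 1) = y k + (q k * e) • X := fun k => by
    simp only [hy, hqs]
    rw [add_assoc, ← add_smul]
    congr 2
    field_simp
    ring
  have hy0 : y 0 = x := by simp [hy, hq]
  -- the points `y k` with `q k * e` at most `(1 + c) * ρ` stay in the region under control
  have hyk : ∀ k, q k * e ≤ (1 + c) * ρ →
      ‖y k - p‖ < r / 2 ∧ τ + q k * e ≤ Metric.infDist (y k) Ωᶜ := by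
    intro k hk
    set s := (q k * e - e) / c with hs
    have hs0 : 0 ≤ s := by
      refine _root_.div_nonneg ?_ hc.le
      nlinarith [hq1 k]
    have hsρ : s ≤ (1 + c) / c * ρ := by
      rw [hs, div_mul_eq_mul_div]
      gcongr
      linarith
    have hs1 : s * (1 + ‖X‖) ≤ ρ * (Λ - 1) := by
      calc s * (1 + ‖X‖) ≤ (1 + c) / c * ρ * (1 + ‖X‖) := by gcongr
        _ = ρ * (Λ - 1) := by rw [hΛ]; ring
    have hsX : 0 ≤ s * ‖X‖ := by positivity
    constructor
    · have h1 : ‖y k - p‖ ≤ ‖x - p‖ + s * ‖X‖ := by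
        have : y k - p = (x - p) + s • X := by simp only [hy, hs]; abel
        rw [this]
        exact (norm_add_le _ _).trans (by rw [norm_smul, Real.norm_of_nonneg hs0])
      linarith
    · have h1 := (hcone' x hxΩ hxr s hs0 (by linarith)).2
      have h2 : c * s = q k * e - e := by rw [hs]; field_simp
      linarith
  have hind : ∀ K : ℕ, (∀ k < K, q k * e < ρ) → ‖fderiv ℝ u x‖ ≤ ‖fderiv ℝ u (y K)‖ +
      G * (C + 2 * κ * N) * ∑ k ∈ Finset.range K, B (q k * e) / (q k * e) := by
    intro K
    induction K with
    | zero => intro _; simp [hy0]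
    | succ K ih =>
      intro hK
      have h1 := ih fun k hk => hK k (by omega)
      have hKρ := hK K (by omega)
      have hqe : 0 < q K * e := mul_pos (one_pos.trans_le (hq1 K)) he0
      obtain ⟨h2, h3⟩ := hyk K (by nlinarith)
      have h4 := hstep B Ω u p X (y K) c C κ r τ N (q K * e) hB.toIsMajorant hu hc.le hκ0.le
        (min_le_left _ _) hτ.le hN hC hcone' htr' hbd h2 hqe (by linarith) h3
      rw [← hys] at h4
      have h5 := norm_sub_norm_le (fderiv ℝ u (y K)) (fderiv ℝ u (y (K + 1)))
      rw [norm_sub_rev] at h5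
      rw [Finset.sum_range_succ, mul_add]
      linarith
  have hex : ∃ K, ρ ≤ q K * e := by
    obtain ⟨K, hK⟩ := pow_unbounded_of_one_lt (ρ / e) (by linarith : 1 < 1 + c)
    rw [div_lt_iff₀ he0] at hK
    exact ⟨K, hK.le⟩
  classical
  set K := Nat.find hex with hKdef
  have hKρ : ρ ≤ q K * e := Nat.find_spec hex
  have hlt : ∀ k < K, q k * e < ρ := fun k hk => not_le.1 (Nat.find_min hex hk)
  have hKle : q K * e ≤ (1 + c) * ρ := by
    rcases hK0 : K with _ | k
    · have : q 0 = 1 := by simp [hq]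
      rw [this]; nlinarith
    · have := hlt k (by omega)
      rw [hqs]; nlinarith
  have h1 := hind K hlt
  obtain ⟨h2, h3⟩ := hyk K hKle
  have h4 : ‖fderiv ℝ u (y K)‖ ≤ M :=
    hM (y K) ⟨mem_closedBall_iff_norm.2 (by linarith), by
      change ρ ≤ _
      linarith⟩
  have h5 := hsum e he0 (by linarith) K
  have h6 := hB.const_le_mul_div hpos hM0 he0 heρ.le
  have hβ := hB.div_nonneg he0
  calc ‖fderiv ℝ u x‖ ≤ M + G * (C + 2 * κ * N) * (S * (B e / e)) := by
        refine h1.trans (add_le_add h4 (mul_le_mul_of_nonneg_left h5 (by positivity)))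
    _ ≤ M * (ρ / B ρ) * (B e / e) + (G * C * S + N * (G * (2 * κ) * S)) * (B e / e) := by
        refine add_le_add h6 (le_of_eq (by ring))
    _ ≤ M * (ρ / B ρ) * (B e / e) + (G * C * S + N * (1 / 2)) * (B e / e) := by gcongr
    _ = _ := by ring

/-- **Gradient estimate.** A harmonic function which is Lipschitz-`B` along curves transversal to
the boundary satisfies `‖∇u‖ ≤ C * B d / d`, where `d` is the distance to the boundary. -/
theorem exists_gradientBound {B : ℝ → ℝ} (hB : IsRegularMajorant B)
    (hpos : ∀ t, 0 < t → 0 < B t) {Ω : Set E} (hΩ : IsOpen Ω) (hbdd : Bornology.IsBounded Ω)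
    {u : E → ℝ} (hu : HarmonicOnNhd u Ω) {C : ℝ} (hC : 0 ≤ C)
    (hloc : ∀ p ∈ frontier Ω, ∃ X, (∃ c > 0, ∃ r > 0, ConeProperty Ω p X c r) ∧
      ∀ κ > 0, ∃ r > 0, NearlyTranslationLipschitz B Ω u p X C κ r) :
    ∃ N, 0 ≤ N ∧ GradientBound B Ω u 0 N := by
  have hcpt : IsCompact (closure Ω) := hbdd.isCompact_closure
  -- self-improvement, with a constant `A` that does not depend on `τ`
  have himp : ∃ A, 0 ≤ A ∧ ∀ τ > 0, ∀ N, 0 ≤ N → GradientBound B Ω u τ N → ∀ x ∈ closure Ω,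
      τ < Metric.infDist x Ωᶜ → ‖fderiv ℝ u x‖ ≤
        (A + N / 2) * (B (Metric.infDist x Ωᶜ - τ) / (Metric.infDist x Ωᶜ - τ)) := by
    refine hcpt.induction_on (p := fun s => ∃ A, 0 ≤ A ∧ ∀ τ > 0, ∀ N, 0 ≤ N →
      GradientBound B Ω u τ N → ∀ x ∈ s, τ < Metric.infDist x Ωᶜ → ‖fderiv ℝ u x‖ ≤
        (A + N / 2) * (B (Metric.infDist x Ωᶜ - τ) / (Metric.infDist x Ωᶜ - τ)))
      ⟨0, le_rfl, by simp⟩ ?_ ?_ ?_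
    · rintro s t hst ⟨A, hA, h⟩
      exact ⟨A, hA, fun τ hτ N hN hb x hx => h τ hτ N hN hb x (hst hx)⟩
    · rintro s t ⟨A, hA, h⟩ ⟨A', hA', h'⟩
      refine ⟨max A A', hA.trans (le_max_left _ _), fun τ hτ N hN hb x hx hxτ => ?_⟩
      have hβ := hB.div_nonneg (sub_pos.2 hxτ)
      rcases hx with hx | hx
      · refine (h τ hτ N hN hb x hx hxτ).trans (mul_le_mul_of_nonneg_right ?_ hβ)
        linarith [le_max_left A A']
      · refine (h' τ hτ N hN hb x hx hxτ).trans (mul_le_mul_of_nonneg_right ?_ hβ)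
        linarith [le_max_right A A']
    · intro p hp
      by_cases hpΩ : p ∈ Ω
      · obtain ⟨δ, hδ, hδΩ⟩ := Metric.nhds_basis_closedBall.mem_iff.1 (hΩ.mem_nhds hpΩ)
        obtain ⟨M, hM0, hM⟩ :=
          HarmonicOnNhd.exists_norm_fderiv_le hΩ hu (isCompact_closedBall p δ) hδΩ
        set D := Metric.infDist p Ωᶜ + δ with hD
        have hD0 : 0 < D := add_pos_of_nonneg_of_pos Metric.infDist_nonneg hδ
        have hBD := hpos D hD0
        refine ⟨Metric.closedBall p δ, mem_nhdsWithin_of_mem_nhds (Metric.closedBall_mem_nhds p hδ),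
          M * (D / B D), by positivity, fun τ hτ N hN _ x hx hxτ => ?_⟩
        have h1 : Metric.infDist x Ωᶜ - τ ≤ D := by
          have h2 := infDist_compl_sub_le Ω x p
          rw [norm_sub_rev] at h2
          have h3 := mem_closedBall_iff_norm.1 hx
          linarith
        have hβ := hB.div_nonneg (sub_pos.2 hxτ)
        refine (hM x hx).trans ((hB.const_le_mul_div hpos hM0 (sub_pos.2 hxτ) h1).trans ?_)
        exact mul_le_mul_of_nonneg_right (by linarith) hβ
      · obtain ⟨X, ⟨c, hc, r, hr, hcone⟩, htr⟩ := hloc p (hΩ.frontier_eq ▸ ⟨hp, hpΩ⟩)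
        obtain ⟨A, hA, ρ, hρ, h⟩ := exists_norm_fderiv_le_near_boundary hB hpos hΩ hu hpΩ hc hr hC
          hcone htr
        exact ⟨Metric.ball p ρ, mem_nhdsWithin_of_mem_nhds (Metric.ball_mem_nhds p hρ), A, hA, h⟩
  obtain ⟨A, hA, himp⟩ := himp
  have himp' : ∀ τ > 0, ∀ N, 0 ≤ N → GradientBound B Ω u τ N → GradientBound B Ω u τ (A + N / 2) :=
    fun τ hτ N hN hb x hx =>
      himp τ hτ N hN hb x (subset_closure (mem_of_infDist_compl_pos (hτ.trans hx))) hx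
  -- away from the boundary, some bound holds, and the self-improvement replaces it by `2 * A`
  have hbound : ∀ τ > 0, GradientBound B Ω u τ (2 * A) := by
    intro τ hτ
    obtain ⟨N₀, hN₀, h0⟩ : ∃ N₀, 0 ≤ N₀ ∧ GradientBound B Ω u τ N₀ := by
      have hK : IsCompact (closure Ω ∩ {y | τ ≤ Metric.infDist y Ωᶜ}) :=
        hcpt.inter_right (isClosed_le continuous_const (Metric.continuous_infDist_pt _))
      obtain ⟨M, hM0, hM⟩ := HarmonicOnNhd.exists_norm_fderiv_le hΩ hu hK
        fun y hy => mem_of_infDist_compl_pos (hτ.trans_le hy.2)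
      obtain ⟨D, hD⟩ := hcpt.exists_bound_of_continuousOn
        (Metric.continuous_infDist_pt Ωᶜ).continuousOn
      set D' := max D 1 with hD'
      have hD'0 : 0 < D' := lt_max_of_lt_right one_pos
      have hBD := hpos D' hD'0
      refine ⟨M * (D' / B D'), by positivity, fun x hx => ?_⟩
      have hxc : x ∈ closure Ω := subset_closure (mem_of_infDist_compl_pos (hτ.trans hx))
      have h1 := (le_abs_self _).trans (hD x hxc)
      exact (hM x ⟨hxc, hx.le⟩).trans (hB.const_le_mul_div hpos hM0 (sub_pos.2 hx)
        (by linarith [le_max_left D 1]))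
    have hiter : ∀ k : ℕ, GradientBound B Ω u τ (2 * A + N₀ * (1 / 2) ^ k) := by
      intro k
      induction k with
      | zero =>
        intro x hx
        refine (h0 x hx).trans (mul_le_mul_of_nonneg_right ?_ (hB.div_nonneg (sub_pos.2 hx)))
        rw [pow_zero]; linarith
      | succ k ih =>
        have h1 := himp' τ hτ _ (by positivity) ih
        have h2 : A + (2 * A + N₀ * (1 / 2) ^ k) / 2 = 2 * A + N₀ * (1 / 2) ^ (k + 1) := by
          rw [pow_succ]; ring
        rwa [h2] at h1
    intro x hx
    have hlim : Tendsto (fun k : ℕ => (2 * A + N₀ * (1 / 2 : ℝ) ^ k) *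
        (B (Metric.infDist x Ωᶜ - τ) / (Metric.infDist x Ωᶜ - τ))) atTop
        (𝓝 ((2 * A + N₀ * 0) * (B (Metric.infDist x Ωᶜ - τ) / (Metric.infDist x Ωᶜ - τ)))) :=
      (((tendsto_pow_atTop_nhds_zero_of_lt_one (by norm_num) (by norm_num)).const_mul
        N₀).const_add _).mul_const _
    rw [mul_zero, add_zero] at hlim
    exact ge_of_tendsto' hlim fun k => hiter k x hx
  refine ⟨4 * A, by positivity, fun x hx => ?_⟩
  set d := Metric.infDist x Ωᶜ with hd
  have h1 := hbound (d / 2) (by positivity) x (by linarith)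
  rw [← hd, sub_half] at h1
  have h2 := hB.div_half_le hx
  rw [sub_zero]
  calc _ ≤ 2 * A * (B (d / 2) / (d / 2)) := h1
    _ ≤ 2 * A * (2 * (B d / d)) := by gcongr
    _ = _ := by ring

end GradientEstimate

/-! ### From the gradient estimate to the Lipschitz condition -/

section HardyLittlewood

variable {E : Type*} [NormedAddCommGroup E] [NormedSpace ℝ E]

/-- Integration of the gradient bound along a segment that leaves the boundary at a definite
rate. -/
lemma GradientBound.abs_sub_le_integral {B : ℝ → ℝ} (hB : IsMajorant B) {Ω : Set E} {u : E → ℝ}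
    {N : ℝ} (hbd : GradientBound B Ω u 0 N) (hN : 0 ≤ N) (hΩ : IsOpen Ω) (hu : ContDiffOn ℝ 1 u Ω)
    {x X : E} {c h : ℝ} (hc : 0 < c) (hh : 0 ≤ h) (hx : ∀ s ∈ Icc 0 h, x + s • X ∈ Ω)
    (hd : ∀ s ∈ Ioc 0 h, c * s ≤ Metric.infDist (x + s • X) Ωᶜ)
    (hint : IntegrableOn (fun t => B t / t) (Ioc 0 (c * h))) :
    |u (x + h • X) - u x| ≤ N * ‖X‖ / c * ∫ t in Ioc 0 (c * h), B t / t := by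
  have hcont : ContinuousOn (fun s : ℝ => fderiv ℝ u (x + s • X) X) (uIcc 0 h) := by
    rw [uIcc_of_le hh]
    have h1 : ContinuousOn (fun s : ℝ => fderiv ℝ u (x + s • X)) (Icc 0 h) :=
      (hu.continuousOn_fderiv_of_isOpen hΩ le_rfl).comp (by fun_prop) hx
    exact h1.clm_apply continuousOn_const
  have hderiv : ∀ s ∈ uIcc 0 h, HasDerivAt (fun s : ℝ => u (x + s • X))
      (fderiv ℝ u (x + s • X) X) s := by
    intro s hs
    rw [uIcc_of_le hh] at hs
    have h1 : HasFDerivAt u (fderiv ℝ u (x + s • X)) (x + s • X) :=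
      ((hu.contDiffAt (hΩ.mem_nhds (hx s hs))).differentiableAt one_ne_zero).hasFDerivAt
    have h2 : HasDerivAt (fun s : ℝ => x + s • X) X s := by
      simpa using ((hasDerivAt_id s).smul_const X).const_add x
    exact h1.comp_hasDerivAt s h2
  have hftc := intervalIntegral.integral_eq_sub_of_hasDerivAt hderiv hcont.intervalIntegrable
  rw [zero_smul, add_zero] at hftc
  have hch : 0 ≤ c * h := by positivity
  have hi : IntervalIntegrable (fun t => B t / t) volume (c * 0) (c * h) := by
    rw [mul_zero]; exact (intervalIntegrable_iff_integrableOn_Ioc_of_le hch).2 hint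
  have hi' : IntervalIntegrable (fun s => N * ‖X‖ * (B (c * s) / (c * s))) volume 0 h := by
    have := (hi.comp_mul_left (c := c)).const_mul (N * ‖X‖)
    simpa [hc.ne'] using this
  rw [← hftc, ← Real.norm_eq_abs]
  refine (intervalIntegral.norm_integral_le_of_norm_le hh
    (Eventually.of_forall fun s hs => ?_) hi').trans (le_of_eq ?_)
  · have hcs : 0 < c * s := mul_pos hc hs.1
    have h1 := hd s hs
    have h2 := hbd (x + s • X) (hcs.trans_le h1)
    rw [sub_zero] at h2
    have h3 := hB.div_le_div hcs h1
    calc ‖fderiv ℝ u (x + s • X) X‖ ≤ ‖fderiv ℝ u (x + s • X)‖ * ‖X‖ :=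
          (fderiv ℝ u (x + s • X)).le_opNorm X
      _ ≤ N * (B (c * s) / (c * s)) * ‖X‖ := by
          gcongr
          exact h2.trans (mul_le_mul_of_nonneg_left h3 hN)
      _ = _ := by ring
  · rw [intervalIntegral.integral_const_mul,
      intervalIntegral.integral_comp_mul_left (fun t => B t / t) hc.ne', mul_zero,
      intervalIntegral.integral_of_le hch, smul_eq_mul]
    ring

/-- Near a boundary point, the gradient bound implies the Lipschitz condition: two points at
distance `δ` are compared with their translates at distance of order `δ` from the boundary. -/
lemma GradientBound.exists_abs_sub_le_near_boundary {B : ℝ → ℝ} (hB : IsRegularMajorant B)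
    {Ω : Set E} {u : E → ℝ} {N : ℝ} (hbd : GradientBound B Ω u 0 N) (hN : 0 ≤ N) (hΩ : IsOpen Ω)
    (hu : ContDiffOn ℝ 1 u Ω) {p X : E} {c r : ℝ} (hc : 0 < c) (hr : 0 < r)
    (hcone : ConeProperty Ω p X c r) :
    ∃ C, 0 ≤ C ∧ ∃ ρ > 0, ∀ x ∈ Metric.ball p ρ, x ∈ Ω → ∀ y ∈ Ω, ‖x - y‖ < ρ →
      |u x - u y| ≤ C * B ‖x - y‖ := by
  obtain ⟨S, hS, δ₀, hδ₀, hint⟩ := hB.exists_integral_le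
  have hdiff : ∀ x ∈ Ω, DifferentiableAt ℝ u x := fun x hx =>
    (hu.contDiffAt (hΩ.mem_nhds hx)).differentiableAt one_ne_zero
  set ρ := min (r / 2) (min (δ₀ / 2) (c * r / 2)) with hρ
  have hρ1 : ρ ≤ r / 2 := min_le_left _ _
  have hρ2 : ρ ≤ δ₀ / 2 := (min_le_right _ _).trans (min_le_left _ _)
  have hρ3 : ρ ≤ c * r / 2 := (min_le_right _ _).trans (min_le_right _ _)
  refine ⟨N + 2 * (N * ‖X‖ / c * (S * 2)), by positivity, ρ, by positivity,
    fun x hxp hx y hy hxy => ?_⟩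
  set δ := ‖x - y‖ with hδ
  rcases (norm_nonneg (x - y)).eq_or_lt with h0 | hδ0
  · have : x = y := sub_eq_zero.1 (norm_eq_zero.1 h0.symm)
    rw [this, sub_self, abs_zero]
    exact mul_nonneg (by positivity) (hB.nonneg _ (norm_nonneg _))
  rw [← hδ] at hδ0
  set h := 2 * δ / c with hh
  have hh0 : 0 < h := by positivity
  have hch : c * h = 2 * δ := by rw [hh]; field_simp
  have hhr : h < r := by rw [hh, div_lt_iff₀ hc]; linarith
  have hxr : x ∈ Metric.ball p r := Metric.ball_subset_ball (by linarith) hxp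
  have hyr : y ∈ Metric.ball p r := by
    rw [mem_ball_iff_norm] at hxp ⊢
    have := norm_sub_le_norm_sub_add_norm_sub y x p
    rw [norm_sub_rev y x] at this
    linarith
  obtain ⟨hi, hi', -, -⟩ := hint (c * h) (by positivity) (by rw [hch]; linarith)
  have hB2 : B (c * h) ≤ 2 * B δ := by rw [hch]; exact hB.two_mul_le hδ0.le
  have hvert : ∀ z ∈ Ω, z ∈ Metric.ball p r →
      |u (z + h • X) - u z| ≤ N * ‖X‖ / c * (S * 2) * B δ := by
    intro z hz hzr
    have h1 := hbd.abs_sub_le_integral hB.toIsMajorant hN hΩ hu (x := z) (X := X) hc hh0.le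
      (fun s hs => (hcone z hz hzr s hs.1 (hs.2.trans_lt hhr)).1)
      (fun s hs => by
        have := (hcone z hz hzr s hs.1.le (hs.2.trans_lt hhr)).2
        linarith [Metric.infDist_nonneg (x := z) (s := Ωᶜ)]) hi
    calc _ ≤ _ := h1
      _ ≤ N * ‖X‖ / c * (S * (2 * B δ)) := by
          gcongr
          exact hi'.trans (by gcongr)
      _ = _ := by ring
  have hx' := (hcone x hx hxr h hh0.le hhr).2
  have hhor : |u (y + h • X) - u (x + h • X)| ≤ N * B δ := by
    have hn : ‖y + h • X - (x + h • X)‖ = δ := by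
      rw [add_sub_add_right_eq_sub, norm_sub_rev]
    have h1 := hbd.abs_sub_le hB.toIsMajorant hN le_rfl hdiff (x := x + h • X) (y := y + h • X)
      hδ0 (by rw [hn]; linarith [Metric.infDist_nonneg (x := x) (s := Ωᶜ)])
    rw [hn] at h1
    refine h1.trans (le_of_eq ?_)
    field_simp
  have h1 := hvert x hx hxr
  have h2 := hvert y hy hyr
  rw [abs_le] at h1 h2 hhor ⊢
  constructor <;> linarith [h1.1, h1.2, h2.1, h2.2, hhor.1, hhor.2]

end HardyLittlewood

section LipschitzMajorant

open InnerProductSpace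

variable {E : Type*} [NormedAddCommGroup E] [InnerProductSpace ℝ E] [FiniteDimensional ℝ E]
  [MeasurableSpace E] [BorelSpace E]

/-- A harmonic function on a bounded domain which is Lipschitz-`B` along curves transversal to the
boundary is Lipschitz-`B`, if `B` does not vanish identically. -/
theorem exists_abs_sub_le_of_nearlyTranslationLipschitz {B : ℝ → ℝ} (hB : IsRegularMajorant B)
    (hpos : ∀ t, 0 < t → 0 < B t) {Ω : Set E} (hΩ : IsOpen Ω) (hbdd : Bornology.IsBounded Ω)
    {u : E → ℝ} (hu : HarmonicOnNhd u Ω) {C : ℝ} (hC : 0 ≤ C)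
    (hloc : ∀ p ∈ frontier Ω, ∃ X, (∃ c > 0, ∃ r > 0, ConeProperty Ω p X c r) ∧
      ∀ κ > 0, ∃ r > 0, NearlyTranslationLipschitz B Ω u p X C κ r) :
    ∃ C' > 0, ∀ x ∈ Ω, ∀ y ∈ Ω, |u x - u y| ≤ C' * B ‖x - y‖ := by
  obtain ⟨N, hN, hbd⟩ := exists_gradientBound hB hpos hΩ hbdd hu hC hloc
  have hu1 : ContDiffOn ℝ 1 u Ω := hu.contDiffOn.of_le (by norm_num)
  have hcpt : IsCompact (closure Ω) := hbdd.isCompact_closure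
  have hBn : ∀ z : E, 0 ≤ B ‖z‖ := fun z => hB.nonneg _ (norm_nonneg _)
  have hlocal : ∃ A, 0 ≤ A ∧ ∃ ρ > 0, ∀ x ∈ closure Ω, x ∈ Ω → ∀ y ∈ Ω, ‖x - y‖ < ρ →
      |u x - u y| ≤ A * B ‖x - y‖ := by
    refine hcpt.induction_on (p := fun s => ∃ A, 0 ≤ A ∧ ∃ ρ > 0, ∀ x ∈ s, x ∈ Ω → ∀ y ∈ Ω,
      ‖x - y‖ < ρ → |u x - u y| ≤ A * B ‖x - y‖) ⟨0, le_rfl, 1, one_pos, by simp⟩ ?_ ?_ ?_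
    · rintro s t hst ⟨A, hA, ρ, hρ, h⟩
      exact ⟨A, hA, ρ, hρ, fun x hx => h x (hst hx)⟩
    · rintro s t ⟨A, hA, ρ, hρ, h⟩ ⟨A', hA', ρ', hρ', h'⟩
      refine ⟨max A A', hA.trans (le_max_left _ _), min ρ ρ', lt_min hρ hρ',
        fun x hx hxΩ y hy hxy => ?_⟩
      rcases hx with hx | hx
      · exact (h x hx hxΩ y hy (hxy.trans_le (min_le_left _ _))).trans
          (mul_le_mul_of_nonneg_right (le_max_left _ _) (hBn _))
      · exact (h' x hx hxΩ y hy (hxy.trans_le (min_le_right _ _))).trans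
          (mul_le_mul_of_nonneg_right (le_max_right _ _) (hBn _))
    · intro p hp
      by_cases hpΩ : p ∈ Ω
      · obtain ⟨δ, hδ, hδΩ⟩ := Metric.nhds_basis_closedBall.mem_iff.1 (hΩ.mem_nhds hpΩ)
        obtain ⟨M, hM0, hM⟩ :=
          HarmonicOnNhd.exists_norm_fderiv_le hΩ hu (isCompact_closedBall p δ) hδΩ
        have hBδ := hpos δ hδ
        refine ⟨Metric.ball p (δ / 2), mem_nhdsWithin_of_mem_nhds
          (Metric.ball_mem_nhds p (half_pos hδ)), M * (δ / B δ), by positivity, δ / 2, half_pos hδ,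
          fun x hx hxΩ y hy hxy => ?_⟩
        have hx' : x ∈ Metric.closedBall p δ :=
          Metric.ball_subset_closedBall (Metric.ball_subset_ball (by linarith) hx)
        have hy' : y ∈ Metric.closedBall p δ := by
          rw [mem_closedBall_iff_norm]
          have h1 := mem_ball_iff_norm.1 hx
          have h2 := norm_sub_le_norm_sub_add_norm_sub y x p
          rw [norm_sub_rev y x] at h2
          linarith
        have h1 : ‖u x - u y‖ ≤ M * ‖x - y‖ :=
          (convex_closedBall p δ).norm_image_sub_le_of_norm_fderiv_le (𝕜 := ℝ)
            (fun z hz => (hu z (hδΩ hz)).1.differentiableAt (by simp)) hM hy' hx'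
        rcases (norm_nonneg (x - y)).eq_or_lt with h0 | h0
        · rw [← h0, mul_zero, Real.norm_eq_abs] at h1
          exact h1.trans (mul_nonneg (by positivity) (hBn _))
        · have h2 := hB.const_le_mul_div hpos hM0 h0 (by linarith : ‖x - y‖ ≤ δ)
          calc |u x - u y| ≤ M * ‖x - y‖ := h1
            _ ≤ M * (δ / B δ) * (B ‖x - y‖ / ‖x - y‖) * ‖x - y‖ := by gcongr
            _ = _ := by field_simp
      · obtain ⟨X, ⟨c, hc, r, hr, hcone⟩, -⟩ := hloc p (hΩ.frontier_eq ▸ ⟨hp, hpΩ⟩)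
        obtain ⟨A, hA, ρ, hρ, h⟩ := hbd.exists_abs_sub_le_near_boundary hB hN hΩ hu1 hc hr hcone
        exact ⟨Metric.ball p ρ, mem_nhdsWithin_of_mem_nhds (Metric.ball_mem_nhds p hρ), A, hA, ρ,
          hρ, h⟩
  obtain ⟨A, hA, ρ, hρ, hlip⟩ := hlocal
  have hlip' : ∀ x ∈ Ω, ∀ y ∈ Ω, ‖x - y‖ < ρ → |u x - u y| ≤ A * B ‖x - y‖ :=
    fun x hx => hlip x (subset_closure hx) hx
  -- points at distance at least `ρ` are dealt with by the boundedness of `u`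
  obtain ⟨M, hM⟩ : ∃ M, ∀ x ∈ closure Ω, x ∈ Ω → |u x| ≤ M := by
    refine hcpt.induction_on (p := fun s => ∃ M, ∀ x ∈ s, x ∈ Ω → |u x| ≤ M)
      ⟨0, by simp⟩ ?_ ?_ ?_
    · rintro s t hst ⟨M, h⟩
      exact ⟨M, fun x hx => h x (hst hx)⟩
    · rintro s t ⟨M, h⟩ ⟨M', h'⟩
      exact ⟨max M M', fun x hx hxΩ => hx.elim (fun hx => (h x hx hxΩ).trans (le_max_left _ _))
        fun hx => (h' x hx hxΩ).trans (le_max_right _ _)⟩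
    · intro p hp
      refine ⟨Metric.ball p (ρ / 2), mem_nhdsWithin_of_mem_nhds
        (Metric.ball_mem_nhds p (half_pos hρ)), ?_⟩
      obtain ⟨x₀, hx₀, hx₀p⟩ := Metric.mem_closure_iff.1 hp (ρ / 2) (half_pos hρ)
      refine ⟨|u x₀| + A * B ρ, fun x hx hxΩ => ?_⟩
      have h1 : ‖x - x₀‖ < ρ := by
        rw [← dist_eq_norm]
        linarith [dist_triangle x p x₀, Metric.mem_ball.1 hx]
      have h2 := (hlip' x hxΩ x₀ hx₀ h1).trans
        (mul_le_mul_of_nonneg_left (hB.mono (norm_nonneg _) h1.le) hA)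
      linarith [abs_sub_abs_le_abs_sub (u x) (u x₀)]
  have hBρ := hpos ρ hρ
  refine ⟨A + 2 * |M| / B ρ + 1, by positivity, fun x hx y hy => ?_⟩
  rcases lt_or_ge ‖x - y‖ ρ with h | h
  · refine (hlip' x hx y hy h).trans (mul_le_mul_of_nonneg_right ?_ (hBn _))
    have : 0 ≤ 2 * |M| / B ρ := by positivity
    linarith
  · have h1 := hB.mono hρ.le h
    calc |u x - u y| ≤ |u x| + |u y| := abs_sub _ _
      _ ≤ 2 * |M| := by
          linarith [hM x (subset_closure hx) hx, hM y (subset_closure hy) hy, le_abs_self M]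
      _ = 2 * |M| / B ρ * B ρ := by field_simp
      _ ≤ (A + 2 * |M| / B ρ + 1) * B ‖x - y‖ := by
          gcongr
          linarith

end LipschitzMajorant

section TransversalFamily

variable {n : ℕ} {Ω : Set (EuclideanSpace ℝ (Fin n))} {a : ℝ}
  {Γ : EuclideanSpace ℝ (Fin n) → ℝ → EuclideanSpace ℝ (Fin n)}

/-- The case of a majorant that does not vanish identically. -/
lemma lipschitzMajorant_of_pos (hΩ_open : IsOpen Ω) (hΩ_bdd : Bornology.IsBounded Ω)
    (hΩ_smooth : HasSmoothBoundary Ω) (hΓ : IsTransversalFamily Ω a Γ) {B : ℝ → ℝ}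
    (hB : IsRegularMajorant B) (hpos : ∀ t, 0 < t → 0 < B t) {u : EuclideanSpace ℝ (Fin n) → ℝ}
    (hu : InnerProductSpace.HarmonicOnNhd u Ω) (hL : TransversallyLipschitz B Ω a Γ u) :
    LipschitzMajorant B Ω u := by
  obtain ⟨C, hC, ε, hε, -, hlip⟩ := hL
  refine exists_abs_sub_le_of_nearlyTranslationLipschitz hB hpos hΩ_open hΩ_bdd hu hC.le
    fun p hp => ⟨deriv (Γ p) 0, ?_, fun κ hκ => ?_⟩
  · exact hΓ.exists_infDist_add_le hΩ_open hΩ_smooth hp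
  · obtain ⟨r, hr, h⟩ := hΓ.exists_curve_through hΩ_smooth hp hκ hε
    refine ⟨r, hr, fun z hz hzr s hs hsr => ?_⟩
    obtain ⟨q, hq, t, ht, rfl, h2⟩ := h z hz hzr
    obtain ⟨h3, h4⟩ := h2 s hs.le hsr
    refine ⟨Γ q (t + s), by rwa [← sub_sub], fun hmem => ?_⟩
    have h5 := hlip q hq (t + s) ⟨by linarith, h3⟩ t ⟨ht, by linarith⟩ hmem hz
    rwa [add_sub_cancel_left, abs_of_pos hs] at h5

/-- The case of the zero majorant: a harmonic function that is constant along the curves is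
constant. It is Hölder continuous by the previous case; as every boundary value is also attained at
interior points, along a curve, so is the supremum of `u`. -/
lemma eq_of_transversallyConstant (hΩ_open : IsOpen Ω) (hΩ_conn : IsConnected Ω)
    (hΩ_bdd : Bornology.IsBounded Ω) (hΩ_smooth : HasSmoothBoundary Ω)
    (hΓ : IsTransversalFamily Ω a Γ) {B : ℝ → ℝ} (hB : ∀ t, 0 ≤ t → B t = 0)
    {u : EuclideanSpace ℝ (Fin n) → ℝ}
    (hu : InnerProductSpace.HarmonicOnNhd u Ω) (hL : TransversallyLipschitz B Ω a Γ u) :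
    ∀ x ∈ Ω, ∀ y ∈ Ω, u x = u y := by
  obtain ⟨C, hC, ε, hε, hεa, hlip⟩ := hL
  have hconst : ∀ p ∈ frontier Ω, ∀ s ∈ Ioo 0 ε, ∀ t ∈ Ioo 0 ε, Γ p s ∈ Ω → Γ p t ∈ Ω →
      u (Γ p s) = u (Γ p t) := by
    intro p hp s hs t ht h1 h2
    have h3 := hlip p hp s hs t ht h1 h2
    rw [hB _ (abs_nonneg _), mul_zero] at h3
    exact sub_eq_zero.1 (abs_nonpos_iff.1 h3)
  have hsqrt : TransversallyLipschitz Real.sqrt Ω a Γ u := by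
    refine ⟨C, hC, ε, hε, hεa, fun p hp s hs t ht h1 h2 => ?_⟩
    rw [hconst p hp s hs t ht h1 h2, sub_self, abs_zero]
    positivity
  obtain ⟨A, hA, hHolder⟩ := lipschitzMajorant_of_pos hΩ_open hΩ_bdd hΩ_smooth hΓ
    isRegularMajorant_sqrt (fun t ht => Real.sqrt_pos.2 ht) hu hsqrt
  have hcpt : IsCompact (closure Ω) := hΩ_bdd.isCompact_closure
  -- the supremum of `u` is attained in `Ω`
  obtain ⟨x₀, hx₀, hmax⟩ : ∃ x₀ ∈ Ω, IsMaxOn u Ω x₀ := by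
    obtain ⟨y₀, hy₀⟩ := hΩ_conn.nonempty
    have hbdd : BddAbove (u '' Ω) := by
      obtain ⟨D, hD⟩ := hΩ_bdd.exists_norm_le
      refine ⟨u y₀ + A * Real.sqrt (D + D), ?_⟩
      rintro _ ⟨x, hx, rfl⟩
      have h1 := (le_abs_self _).trans (hHolder x hx y₀ hy₀)
      have h2 : ‖x - y₀‖ ≤ D + D := (norm_sub_le _ _).trans (add_le_add (hD x hx) (hD y₀ hy₀))
      have h3 := mul_le_mul_of_nonneg_left (Real.sqrt_le_sqrt h2) hA.le
      linarith
    set m := sSup (u '' Ω) with hm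
    have hle : ∀ x ∈ Ω, u x ≤ m := fun x hx => le_csSup hbdd ⟨x, hx, rfl⟩
    obtain ⟨v, -, hv, hvmem⟩ := exists_seq_tendsto_sSup ⟨u y₀, mem_image_of_mem u hy₀⟩ hbdd
    choose x hxΩ hxv using hvmem
    obtain ⟨z, hz, φ, hφ, hxz⟩ := hcpt.tendsto_subseq fun k => subset_closure (hxΩ k)
    have hum : Tendsto (fun k => u (x (φ k))) atTop (𝓝 m) := by
      have := hv.comp hφ.tendsto_atTop
      simpa only [Function.comp_def, ← hxv] using this
    have hbound : ∀ w ∈ Ω, |m - u w| ≤ A * Real.sqrt ‖z - w‖ := by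
      intro w hw
      have h1 : Tendsto (fun k => A * Real.sqrt ‖x (φ k) - w‖) atTop
          (𝓝 (A * Real.sqrt ‖z - w‖)) :=
        ((Real.continuous_sqrt.tendsto _).comp (hxz.sub_const w).norm).const_mul A
      exact le_of_tendsto_of_tendsto' (hum.sub_const (u w)).abs h1
        fun k => hHolder _ (hxΩ _) w hw
    by_cases hzΩ : z ∈ Ω
    · have h1 := hbound z hzΩ
      rw [sub_self, norm_zero, Real.sqrt_zero, mul_zero, abs_nonpos_iff, sub_eq_zero] at h1
      exact ⟨z, hzΩ, fun w hw => h1 ▸ hle w hw⟩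
    · have hzf : z ∈ frontier Ω := hΩ_open.frontier_eq ▸ ⟨hz, hzΩ⟩
      obtain ⟨hin, hlim⟩ := hΓ.eventually_mem hΩ_smooth hzf
      have hev := hin.and (Ioo_mem_nhdsGT hε)
      obtain ⟨s, hs, hsε⟩ := hev.exists
      have h1 : Tendsto (fun t => A * Real.sqrt ‖z - Γ z t‖) (𝓝[>] 0) (𝓝 0) := by
        have h2 : Tendsto (fun t => A * Real.sqrt ‖z - Γ z t‖) (𝓝[>] 0)
            (𝓝 (A * Real.sqrt ‖z - z‖)) :=
          ((Real.continuous_sqrt.tendsto _).comp (hlim.const_sub z).norm).const_mul A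
        simpa using h2
      have h2 : |m - u (Γ z s)| ≤ 0 := by
        refine ge_of_tendsto h1 ?_
        filter_upwards [hev] with t ht
        rw [hconst z hzf s hsε t ht.2 hs ht.1]
        exact hbound _ ht.1
      rw [abs_nonpos_iff, sub_eq_zero] at h2
      exact ⟨Γ z s, hs, fun w hw => h2 ▸ hle w hw⟩
  have := eq_of_harmonic_of_isMaxOn hΩ_open hΩ_conn.isPreconnected hu hx₀ hmax
  intro x hx y hy
  rw [this x hx, this y hy]

end TransversalFamily

theorem mainTheorem1 {n : ℕ} (Ω : Set (EuclideanSpace ℝ (Fin n)))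
    (hΩ_open : IsOpen Ω) (hΩ_conn : IsConnected Ω) (hΩ_bdd : Bornology.IsBounded Ω)
    (hΩ_smooth : HasSmoothBoundary Ω)
    (a : ℝ) (Γ : EuclideanSpace ℝ (Fin n) → ℝ → EuclideanSpace ℝ (Fin n))
    (hΓ : IsTransversalFamily Ω a Γ)
    (B : ℝ → ℝ) (hB : IsRegularMajorant B)
    (u : EuclideanSpace ℝ (Fin n) → ℝ) (hu : InnerProductSpace.HarmonicOnNhd u Ω)
    (hL : TransversallyLipschitz B Ω a Γ u) :
    LipschitzMajorant B Ω u := by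
  rcases hB.eq_zero_or_pos with h0 | hpos
  · refine ⟨1, one_pos, fun x hx y hy => ?_⟩
    rw [eq_of_transversallyConstant hΩ_open hΩ_conn hΩ_bdd hΩ_smooth hΓ h0 hu hL x hx y hy,
      sub_self, abs_zero, h0 _ (norm_nonneg _), mul_zero]
  · exact lipschitzMajorant_of_pos hΩ_open hΩ_bdd hΩ_smooth hΓ hB hpos hu hL
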